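/- **Setting.** Let $\mathcal X,\mathcal Y$ be finite alphabets, $Q(\cdot|\cdot)$ a discrete memoryless channel from $\mathcal X$ to $\mathcal Y$, and $\star\in\mathcal X$ a noise symbol. A code of block length $N$ consists of $M\ge 2$ codewords $c(1),\dots,c(M)\in\mathcal X^N$ and a decoder $(\tau,\phi)$, where $\tau\in\{1,2,\dots\}$ is a stopping time of the outputs $Y_1,Y_2,\dots$ and $\phi$ is an $\mathcal F_\tau$-measurable message estimate ($\mathcal F_n=\sigma(Y_1,\dots,Y_n)$). At integer asynchronism level $A\ge1$ the message $m$ is uniform on $\{1,\dots,M\}$, and the start time $\nu$ is independent of it and uniform on $\{1,\dots,A\}$. Given $m$ and $\nu$, the outputs are independent; $Y_i$ has law $Q(\cdot|c_{i-\nu+1}(m))$ if $\nu\le i\le\nu+N-1$ and law $Q(\cdot|\star)$ otherwise. The error probability $\mathbb P(\mathcal E)$ is the probability that $\phi\neq m$, and the rate is $\ln M/\mathbb E(\tau-\nu)^+$. Below, an asynchronism level $e^{aN}$ is rounded up to an integer. An exponent $\alpha\ge0$ is achievable at rate $R$ if for every $\varepsilon>0$ there are codes of arbitrarily large block length $N$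 which, at asynchronism level $A=e^{(\alpha-\varepsilon)N}$, have rate at least $R-\varepsilon$ and $\mathbb P(\mathcal E)\le\varepsilon$. The synchronization threshold $\alpha(Q)\in[0,\infty]$ is the supremum of the exponents achievable at rate $R=0$ (with $\sup\emptyset=0$). **Theorem.** For every such channel: 1. $\displaystyle \alpha(Q)=\max_{x\in\mathcal X}D\big(Q(\cdot|x)\,\|\,Q(\cdot|\star)\big)$, where $D$ is the Kullback–Leibler divergence in nats, possibly $+\infty$. 2. For every $0\le\alpha<\alpha(Q)$ there is a coding strategy, i.e. a sequence of codes, one for each block length $N$ with $M=M_N$ messages, whose error probability at asynchronism level $A=e^{\alpha N}$ tends to $0$ as $N\to\infty$, and for which $\lim_{N\to\infty}\ln M_N/N$ exists and is strictly positive. 3. If there is $y\in\mathcal Y$ with $Q(y|\star)=0$ and $Q(y|x)>0$ for some $x\in\mathcal X$, then $\alpha(Q)=\infty$: every $\alpha\ge0$ is achievable at rate $0$, and for every $\alpha\ge0$ there is a coding strategy as in 2. -/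

import Mathlib

open MeasureTheory ProbabilityTheory InformationTheory Filter Topology
open scoped NNReal ENNReal

noncomputable section

namespace AsyncComm

/-- A block code of length `N` with a sequential decoder. The output alphabet carries its discrete
`σ`-algebra; the outputs `Y₁, Y₂, …` are the coordinates of a point of `ℕ+ → Y`, and
`Filtration.piLE n` is the `σ`-algebra generated by `Y₁, …, Yₙ`. -/
structure Code (X Y : Type*) [MeasurableSpace Y] (N : ℕ) where
  /-- the number of messages -/
  M : ℕ
  two_le_M : 2 ≤ M
  /-- the codewords (symbols are numbered from `0` to `N - 1`) -/
  codeword : Fin M → Fin N → X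
  /-- the decoding time -/
  τ : (ℕ+ → Y) → ℕ+
  isStoppingTime :
    IsStoppingTime (Filtration.piLE (X := fun _ : ℕ+ => Y)) fun y => (τ y : WithTop ℕ+)
  /-- the declared message -/
  φ : (ℕ+ → Y) → Fin M
  measurable_φ : Measurable[isStoppingTime.measurableSpace] φ

/-- The channel input at time `i` when the codeword `c` starts being sent at time `l`: the codeword
is sent during `l, …, l + N - 1`, and the noise symbol is the input at all other times. -/
def inputAt {X : Type*} {N : ℕ} (star : X) (c : Fin N → X) (l : ℕ) (i : ℕ+) : X :=
  if h : l ≤ (i : ℕ) ∧ (i : ℕ) < l + N then c ⟨(i : ℕ) - l, by omega⟩ else star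

/-- The law of the outputs `Y₁, Y₂, …` when the codeword `c` starts being sent at time `l` over the
memoryless channel `Q`. -/
def outputLaw {X Y : Type*} [MeasurableSpace Y] {N : ℕ} (Q : X → PMF Y) (star : X)
    (c : Fin N → X) (l : ℕ) : Measure (ℕ+ → Y) :=
  Measure.infinitePi fun i : ℕ+ => (Q (inputAt star c l i)).toMeasure

/-- The average decoding error probability at asynchronism level `A ≥ 1`: the message and the start
time, uniform on `{1, …, A}`, are independent. -/
def errorProb {X Y : Type*} [MeasurableSpace Y] {N : ℕ} (Q : X → PMF Y) (star : X) (A : ℕ)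
    (C : Code X Y N) : ℝ :=
  (1 / (A : ℝ)) * (1 / (C.M : ℝ)) * ∑ m : Fin C.M, ∑ l ∈ Finset.Icc 1 A,
    (outputLaw Q star (C.codeword m) l).real {y | C.φ y ≠ m}

/-- The average reaction delay `𝔼 (τ - ν)⁺` at asynchronism level `A ≥ 1` (the subtraction of natural
numbers is the positive part of the difference). -/
def delay {X Y : Type*} [MeasurableSpace Y] {N : ℕ} (Q : X → PMF Y) (star : X) (A : ℕ)
    (C : Code X Y N) : ℝ≥0∞ :=
  (A : ℝ≥0∞)⁻¹ * (C.M : ℝ≥0∞)⁻¹ * ∑ m : Fin C.M, ∑ l ∈ Finset.Icc 1 A,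
    ∫⁻ y, (((C.τ y : ℕ) - l : ℕ) : ℝ≥0∞) ∂(outputLaw Q star (C.codeword m) l)

/-- The rate `ln M / 𝔼 (τ - ν)⁺` (infinite if the delay is zero). -/
def rate {X Y : Type*} [MeasurableSpace Y] {N : ℕ} (Q : X → PMF Y) (star : X) (A : ℕ)
    (C : Code X Y N) : ℝ≥0∞ :=
  ENNReal.ofReal (Real.log C.M) / delay Q star A C

/-- The asynchronism level `e ^ (a N)`, rounded up to an integer (which is at least `1`). -/
def level (a : ℝ) (N : ℕ) : ℕ := ⌈Real.exp (a * N)⌉₊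

/-- The asynchronism exponent `α` is achievable at rate `R`: for every `ε > 0` there are codes of
arbitrarily large block length `N`, operating at asynchronism level `e ^ ((α - ε) N)`, with rate at
least `R - ε` and error probability at most `ε`. -/
def IsAchievable {X Y : Type*} [MeasurableSpace Y] (Q : X → PMF Y) (star : X) (α R : ℝ) : Prop :=
  ∀ ε : ℝ, 0 < ε → ∀ N₀ : ℕ, ∃ N : ℕ, N₀ ≤ N ∧ ∃ C : Code X Y N,
    ENNReal.ofReal (R - ε) ≤ rate Q star (level (α - ε) N) C ∧
      errorProb Q star (level (α - ε) N) C ≤ ε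

/-- The supremum of the asynchronism exponents that are achievable at rate `R`. -/
def exponentFunction {X Y : Type*} [MeasurableSpace Y] (Q : X → PMF Y) (star : X) (R : ℝ) :
    ℝ≥0∞ :=
  ⨆ (α : ℝ≥0) (_ : IsAchievable Q star α R), (α : ℝ≥0∞)

/-- The synchronization threshold `α(Q)`. -/
def synchronizationThreshold {X Y : Type*} [MeasurableSpace Y] (Q : X → PMF Y) (star : X) :
    ℝ≥0∞ :=
  exponentFunction Q star 0

/-- Some coding strategy (one code for each block length `N`) has vanishing error probability at the
asynchronism levels `e ^ (α N)`, while `ln M / N` converges to a positive limit. -/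
def HasPositiveRateStrategy {X Y : Type*} [MeasurableSpace Y] (Q : X → PMF Y) (star : X)
    (α : ℝ) : Prop :=
  ∃ C : (N : ℕ) → Code X Y N,
    Tendsto (fun N => errorProb Q star (level α N) (C N)) atTop (𝓝 0) ∧
      ∃ r : ℝ, 0 < r ∧ Tendsto (fun N : ℕ => Real.log (C N).M / N) atTop (𝓝 r)

end AsyncComm

end

/-! Write `D` for the largest divergence of a channel law `Q x` from the noise law.

Achievability. Let `x` satisfy `a < klDiv (Q x) (Q star)`. Codewords are drawn i.i.d. with letter
`x` of probability `1 - δ` and letter `star` of probability `δ`. The decoder slides a window of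
length `N` and stops at the first one that passes the test of some codeword: two additive scores
must exceed thresholds. The score `F` is a Donsker–Varadhan potential of `Q x` against noise, so a
pure-noise window passes with probability at most `exp (-N θ₁)`; with `θ₁ > a` this survives a union
bound over `exp (a N)` windows and exponentially many messages. The fewer than `2 N` windows that
overlap the codeword are handled by `G`: whatever the output word is, an independent random codeword
fits it with probability at most `exp (-N θ₂)`. A small `δ > 0` costs little in `F` and makes
codewords differ enough for `θ₂ > 0`. A wrong window accepted by the test of the right message is no
error, and at rate `0` the delay is unconstrained. See `exists_code_errorProb_le` and
`hasPositiveRateStrategy_of_lt_klDiv`.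

Converse, for `D < ∞`. Relative to pure noise, the output law with start time `l` has as density the
likelihood ratio of the window at `l`. Truncated at `T = exp (N (D + γ))`, which loses exponentially
little mass, these ratios are bounded by `T`, have mean at most `1`, and are independent at distance
`N`; so their average over `l ≤ A` concentrates once `A` is much larger than `N T`. Hence no event
is noticeably more likely under the averaged output law than under noise (`sum_outputLaw_le`). For
the events "message `m` is declared" the noise probabilities sum to `1`, so the success probability
is at most about `1 / M ≤ 1 / 2`, contradicting small error.

If `D = ∞` the converse is void; this happens exactly when some letter reachable from an input is
impossible under noise. -/

namespace AsyncComm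

/-! ### Product weights on words and Chernoff bounds. -/

/-- The total weight of a set of words under the product of the letter weights `q j`. -/
noncomputable def wordWeight {N : ℕ} {Y : Type*} [Fintype Y] (q : Fin N → Y → ℝ)
    (S : Set (Fin N → Y)) : ℝ :=
  ∑ w, S.indicator (fun w => ∏ j, q j (w j)) w

lemma sum_prod_eq_prod_sum {N : ℕ} {Y : Type*} [Fintype Y] (q : Fin N → Y → ℝ) :
    ∑ w : Fin N → Y, ∏ j, q j (w j) = ∏ j, ∑ y, q j y := by
  classical
  rw [Finset.prod_univ_sum, Fintype.piFinset_univ]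

/-- The exponential Markov inequality for product weights. -/
lemma wordWeight_le_exp {N : ℕ} {Y : Type*} [Fintype Y] {q : Fin N → Y → ℝ}
    (hq : ∀ j y, 0 ≤ q j y) (h : Fin N → Y → ℝ) (θ : ℝ) {S : Set (Fin N → Y)}
    (hS : ∀ w ∈ S, θ ≤ ∑ j, h j (w j)) :
    wordWeight q S ≤ Real.exp (-θ) * ∏ j, ∑ y, q j y * Real.exp (h j y) := by
  rw [← sum_prod_eq_prod_sum (fun j y => q j y * Real.exp (h j y)), Finset.mul_sum]
  refine Finset.sum_le_sum fun w _ => ?_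
  have h0 : 0 ≤ ∏ j, q j (w j) := Finset.prod_nonneg fun j _ => hq j (w j)
  rw [Finset.prod_mul_distrib, ← Real.exp_sum, mul_left_comm, ← Real.exp_add]
  by_cases hw : w ∈ S
  · rw [Set.indicator_of_mem hw]
    refine le_mul_of_one_le_right h0 (Real.one_le_exp ?_)
    linarith [hS w hw]
  · rw [Set.indicator_of_notMem hw]
    positivity

/-- Finitely many bounded variables with negative means have a common exponential moment below
`1`. -/
lemma exists_exp_moment_lt_one {ι α : Type*} [Finite ι] [Fintype α] {q : ι → α → ℝ}
    (hq1 : ∀ i, ∑ a, q i a = 1) (h : ι → α → ℝ)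
    (hneg : ∀ i, ∑ a, q i a * h i a < 0) :
    ∃ t : ℝ, 0 < t ∧ ∃ ρ : ℝ, 0 < ρ ∧ ρ < 1 ∧ ∀ i, ∑ a, q i a * Real.exp (t * h i a) ≤ ρ := by
  -- The moment generating function is `1` at `t = 0` and its derivative there is the mean, which is
  -- negative.
  have key : ∀ i, ∀ᶠ t : ℝ in 𝓝[>] 0, ∑ a, q i a * Real.exp (t * h i a) < 1 := by
    intro i
    have hd : HasDerivAt (fun t : ℝ => ∑ a, q i a * Real.exp (t * h i a))
        (∑ a, q i a * h i a) 0 := by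
      refine HasDerivAt.fun_sum fun a _ => ?_
      have := ((hasDerivAt_mul_const (x := (0 : ℝ)) (h i a)).exp).const_mul (q i a)
      simpa using this
    have hlt := (hasDerivAt_iff_tendsto_slope.1 hd).mono_left
      (nhdsWithin_mono 0 fun t (ht : 0 < t) => ht.ne')
    filter_upwards [hlt.eventually (gt_mem_nhds (hneg i)), self_mem_nhdsWithin] with t ht ht0
    rw [slope_def_field, sub_zero, div_neg_iff] at ht
    have ht0 : (0 : ℝ) < t := ht0
    have : ∑ a, q i a * Real.exp (0 * h i a) = 1 := by simp [hq1]
    rw [this] at ht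
    rcases ht with ht | ht <;> linarith [ht.1, ht.2]
  obtain ⟨t, ht, ht0⟩ := ((eventually_all.2 key).and self_mem_nhdsWithin).exists
  have h1 : ∀ i, ∀ᶠ ρ : ℝ in 𝓝[<] 1, ∑ a, q i a * Real.exp (t * h i a) ≤ ρ := fun i =>
    ((lt_mem_nhds (ht i)).filter_mono nhdsWithin_le_nhds).mono fun _ => le_of_lt
  have h2 : ∀ᶠ ρ : ℝ in 𝓝[<] 1, 0 < ρ :=
    (lt_mem_nhds zero_lt_one).filter_mono nhdsWithin_le_nhds
  obtain ⟨ρ, hρ, hρ0, hρ1⟩ := ((eventually_all.2 h1).and (h2.and self_mem_nhdsWithin)).exists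
  exact ⟨t, ht0, ρ, hρ0, hρ1, hρ⟩

lemma sum_toReal_pmf {Y : Type*} [Fintype Y] (p : PMF Y) : ∑ y, (p y).toReal = 1 := by
  have h := p.tsum_coe
  rw [tsum_fintype] at h
  rw [← ENNReal.toReal_sum fun y _ => p.apply_ne_top y, h, ENNReal.toReal_one]

/-! ### Divergence on a finite alphabet and its variational form. -/

section Divergence

variable {Y : Type*} [Fintype Y] [MeasurableSpace Y] [MeasurableSingletonClass Y]

lemma pmf_absolutelyContinuous_iff (p q : PMF Y) :
    p.toMeasure ≪ q.toMeasure ↔ ∀ y, q y = 0 → p y = 0 := by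
  constructor
  · intro h y hy
    have := h (s := {y}) (by rwa [q.toMeasure_apply_singleton _ (measurableSet_singleton y)])
    rwa [p.toMeasure_apply_singleton _ (measurableSet_singleton y)] at this
  · intro h s hs
    rw [PMF.toMeasure_apply_eq_zero_iff _ (Set.toFinite s).measurableSet,
      Set.disjoint_left] at hs ⊢
    intro y hy hys
    exact hs (fun hq => hy (h y hq)) hys

lemma pmf_rnDeriv (p q : PMF Y) (h : p.toMeasure ≪ q.toMeasure) {y : Y} (hy : q y ≠ 0) :
    p.toMeasure.rnDeriv q.toMeasure y = p y / q y := by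
  have h1 := Measure.setLIntegral_rnDeriv h {y}
  rw [lintegral_singleton, p.toMeasure_apply_singleton _ (measurableSet_singleton y),
    q.toMeasure_apply_singleton _ (measurableSet_singleton y)] at h1
  rw [← h1, ENNReal.mul_div_cancel_right hy (q.apply_ne_top y)]

lemma klDiv_pmf_ne_top_iff (p q : PMF Y) :
    klDiv p.toMeasure q.toMeasure ≠ ⊤ ↔ ∀ y, q y = 0 → p y = 0 := by
  rw [klDiv_ne_top_iff, pmf_absolutelyContinuous_iff]
  exact and_iff_left Integrable.of_finite

lemma sum_mul_log_eq_klDiv (p q : PMF Y) (h : ∀ y, q y = 0 → p y = 0) :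
    ∑ y, (p y).toReal * Real.log ((p y).toReal / (q y).toReal) =
      (klDiv p.toMeasure q.toMeasure).toReal := by
  have hac := (pmf_absolutelyContinuous_iff p q).2 h
  rw [toReal_klDiv_of_measure_eq hac (by simp), PMF.integral_eq_sum]
  refine Finset.sum_congr rfl fun y _ => ?_
  by_cases hp : p y = 0
  · simp [hp]
  · rw [smul_eq_mul, llr, pmf_rnDeriv p q hac (fun hq => hp (h y hq)), ENNReal.toReal_div]

/-- The easy half of the Donsker–Varadhan variational formula. -/
lemma exists_potential_of_lt_klDiv (p q : PMF Y) {a : ℝ≥0}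
    (ha : (a : ℝ≥0∞) < klDiv p.toMeasure q.toMeasure) :
    ∃ f : Y → ℝ, (a : ℝ) < ∑ y, (p y).toReal * f y ∧ ∑ y, (q y).toReal * Real.exp (f y) ≤ 1 := by
  classical
  by_cases h : ∀ y, q y = 0 → p y = 0
  · have hfin := (klDiv_pmf_ne_top_iff p q).2 h
    set D := (klDiv p.toMeasure q.toMeasure).toReal with hD
    have haD : (a : ℝ) < D := by
      rw [← ENNReal.ofReal_toReal hfin, ← ENNReal.ofReal_coe_nnreal] at ha
      exact (ENNReal.ofReal_lt_ofReal_iff_of_nonneg a.2).1 ha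
    -- The slack `κ` plays two roles: `exp` of the score is proportional to `κ` on letters with `p y
    -- = 0`, where the log-ratio is unusable, and the shift by `-κ` restores the normalisation,
    -- since `(1 + κ) * exp (-κ) ≤ 1`.
    obtain ⟨κ, hκ, hκ'⟩ : ∃ κ : ℝ, 0 < κ ∧ (a : ℝ) < D - κ := ⟨(D - a) / 2, by linarith, by linarith⟩
    refine ⟨fun y => (if p y = 0 then Real.log κ
      else Real.log ((p y).toReal / (q y).toReal)) - κ, ?_, ?_⟩
    · have : ∑ y, (p y).toReal * ((if p y = 0 then Real.log κ
          else Real.log ((p y).toReal / (q y).toReal)) - κ) = D - κ := by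
        simp_rw [mul_sub, Finset.sum_sub_distrib, ← Finset.sum_mul, sum_toReal_pmf, one_mul, hD,
          ← sum_mul_log_eq_klDiv p q h]
        congr 1
        refine Finset.sum_congr rfl fun y _ => ?_
        by_cases hp : p y = 0 <;> simp [hp]
      rwa [this]
    · have hle : ∀ y, (q y).toReal * Real.exp ((if p y = 0 then Real.log κ
          else Real.log ((p y).toReal / (q y).toReal)) - κ) ≤
          ((p y).toReal + (q y).toReal * κ) * Real.exp (-κ) := by
        intro y
        rw [sub_eq_add_neg, Real.exp_add, ← mul_assoc]
        refine mul_le_mul_of_nonneg_right ?_ (Real.exp_pos _).le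
        by_cases hp : p y = 0
        · simp [hp, Real.exp_log hκ]
        · have hq : 0 < (q y).toReal :=
            ENNReal.toReal_pos (fun hq => hp (h y hq)) (q.apply_ne_top y)
          have hp' : 0 < (p y).toReal := ENNReal.toReal_pos hp (p.apply_ne_top y)
          rw [if_neg hp, Real.exp_log (by positivity), mul_div_cancel₀ _ hq.ne']
          have : 0 ≤ (q y).toReal * κ := by positivity
          linarith
      refine (Finset.sum_le_sum fun y _ => hle y).trans ?_
      rw [← Finset.sum_mul, Finset.sum_add_distrib, ← Finset.sum_mul, sum_toReal_pmf,
        sum_toReal_pmf, one_mul, Real.exp_neg, ← div_eq_mul_inv, div_le_one (Real.exp_pos _)]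
      linarith [Real.add_one_le_exp κ]
  -- Without absolute continuity, a letter of zero `q`-mass can carry an arbitrarily large score at
  -- no cost.
  · push Not at h
    obtain ⟨y₀, hq, hp⟩ := h
    have hp' : 0 < (p y₀).toReal := ENNReal.toReal_pos hp (p.apply_ne_top y₀)
    refine ⟨fun y => if y = y₀ then ((a : ℝ) + 1) / (p y₀).toReal else 0, ?_, ?_⟩
    · simp only [mul_ite, mul_zero, Finset.sum_ite_eq', Finset.mem_univ, if_true]
      rw [mul_div_cancel₀ _ hp'.ne']
      linarith
    · rw [← sum_toReal_pmf q]
      refine Finset.sum_le_sum fun y _ => ?_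
      by_cases hy : y = y₀
      · simp [hy, hq]
      · simp [hy]

end Divergence

/-! ### Windows of outputs and their laws. -/

section Window

variable {X Y : Type*} {N : ℕ}

/-- The block of `N` outputs observed at times `s, …, s + N - 1`. -/
def window (N s : ℕ) (y : ℕ+ → Y) : Fin N → Y := fun j => y (s + j : ℕ).toPNat'

lemma coe_toPNat'_of_pos {n : ℕ} (hn : 0 < n) : ((n.toPNat' : ℕ+) : ℕ) = n := by
  simp [Nat.toPNat'_coe, hn]

/-- Times start at `1`, and `Nat.toPNat'` sends `0` to `1`; the condition `1 ≤ s` excludes this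
collision. -/
lemma window_injective {s : ℕ} (hs : 1 ≤ s) :
    Function.Injective fun j : Fin N => (s + j : ℕ).toPNat' := by
  intro i j hij
  have := congrArg (fun n : ℕ+ => (n : ℕ)) hij
  simp only [coe_toPNat'_of_pos (show 0 < s + (i : ℕ) by omega),
    coe_toPNat'_of_pos (show 0 < s + (j : ℕ) by omega)] at this
  exact Fin.ext (by omega)

lemma inputAt_window_self (star : X) (c : Fin N → X) {l : ℕ} (hl : 1 ≤ l) (j : Fin N) :
    inputAt star c l (l + j : ℕ).toPNat' = c j := by
  have hj := j.2
  have h := coe_toPNat'_of_pos (show 0 < l + (j : ℕ) by omega)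
  rw [inputAt, dif_pos (by omega)]
  congr 1
  exact Fin.ext (by simp only [h]; omega)

lemma inputAt_of_lt_or_le (star : X) (c : Fin N → X) {l : ℕ} {i : ℕ+}
    (h : (i : ℕ) < l ∨ l + N ≤ i) : inputAt star c l i = star := by
  rw [inputAt, dif_neg (by omega)]

lemma inputAt_window_of_disjoint (star : X) (c : Fin N → X) {l s : ℕ} (hs : 1 ≤ s)
    (h : s + N ≤ l ∨ l + N ≤ s) (j : Fin N) : inputAt star c l (s + j : ℕ).toPNat' = star := by
  have hj := j.2
  refine inputAt_of_lt_or_le star c ?_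
  rw [coe_toPNat'_of_pos (show 0 < s + (j : ℕ) by omega)]
  omega

variable [MeasurableSpace Y]

instance (Q : X → PMF Y) (star : X) (c : Fin N → X) (l : ℕ) :
    IsProbabilityMeasure (outputLaw Q star c l) := by
  unfold outputLaw; infer_instance

lemma measurable_window (s : ℕ) : Measurable (window N s : (ℕ+ → Y) → Fin N → Y) :=
  measurable_pi_lambda _ fun _ => measurable_pi_apply _

lemma map_window_outputLaw (Q : X → PMF Y) (star : X) (c : Fin N → X) (l : ℕ) {s : ℕ}
    (hs : 1 ≤ s) : (outputLaw Q star c l).map (window N s) =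
      Measure.pi fun j : Fin N => (Q (inputAt star c l (s + j : ℕ).toPNat')).toMeasure := by
  rw [← Measure.infinitePi_eq_pi]
  exact Measure.map_infinitePi_infinitePi_of_inj (window_injective hs)

variable [Fintype Y] [MeasurableSingletonClass Y]

lemma pi_real_eq_wordWeight (p : Fin N → PMF Y) (S : Set (Fin N → Y)) :
    (Measure.pi fun j => (p j).toMeasure).real S =
      wordWeight (fun j y => (p j y).toReal) S := by
  classical
  have hS : S = ((Finset.univ.filter (· ∈ S) : Finset (Fin N → Y)) : Set (Fin N → Y)) := by
    ext; simp
  rw [hS, ← sum_measureReal_singleton, wordWeight, ← hS, Finset.sum_filter]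
  refine Finset.sum_congr rfl fun w _ => ?_
  by_cases hw : w ∈ S
  · rw [if_pos hw, Set.indicator_of_mem hw, measureReal_def, Measure.pi_singleton,
      ENNReal.toReal_prod]
    exact Finset.prod_congr rfl fun j _ => by
      rw [(p j).toMeasure_apply_singleton _ (measurableSet_singleton _)]
  · rw [if_neg hw, Set.indicator_of_notMem hw]

lemma outputLaw_real_window (Q : X → PMF Y) (star : X) (c : Fin N → X) (l : ℕ) {s : ℕ}
    (hs : 1 ≤ s) (S : Set (Fin N → Y)) : (outputLaw Q star c l).real {y | window N s y ∈ S} =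
      wordWeight (fun j y => (Q (inputAt star c l (s + j : ℕ).toPNat') y).toReal) S := by
  rw [← pi_real_eq_wordWeight fun j : Fin N => Q (inputAt star c l (s + j : ℕ).toPNat'),
    ← map_window_outputLaw Q star c l hs,
    map_measureReal_apply (measurable_window s) (Set.toFinite S).measurableSet]
  rfl

lemma outputLaw_real_window_self (Q : X → PMF Y) (star : X) (c : Fin N → X) {l : ℕ}
    (hl : 1 ≤ l) (S : Set (Fin N → Y)) : (outputLaw Q star c l).real {y | window N l y ∈ S} =
      wordWeight (fun j y => (Q (c j) y).toReal) S := by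
  rw [outputLaw_real_window Q star c l hl]
  simp_rw [inputAt_window_self star c hl]

lemma outputLaw_real_window_of_disjoint (Q : X → PMF Y) (star : X) (c : Fin N → X) {l s : ℕ}
    (hs : 1 ≤ s) (h : s + N ≤ l ∨ l + N ≤ s) (S : Set (Fin N → Y)) :
    (outputLaw Q star c l).real {y | window N s y ∈ S} =
      wordWeight (fun _ y => (Q star y).toReal) S := by
  rw [outputLaw_real_window Q star c l hs]
  simp_rw [inputAt_window_of_disjoint star c hs h]

end Window

/-! ### The sliding-window decoder and its causality. -/

section SequentialDecoder

variable {X Y : Type*}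

/-- Such a set is the preimage of its own image in the words of length `n`, and every set of such
words is measurable because there are finitely many. -/
lemma measurableSet_piLE_of_forall [MeasurableSpace Y] [Finite Y]
    [MeasurableSingletonClass Y] {n : ℕ+} {S : Set (ℕ+ → Y)}
    (h : ∀ y y' : ℕ+ → Y, (∀ i ≤ n, y i = y' i) → y ∈ S → y' ∈ S) :
    MeasurableSet[Filtration.piLE (X := fun _ : ℕ+ => Y) n] S := by
  have : Finite (Set.Iic n) := (Set.finite_Iic n).to_subtype
  refine ⟨Preorder.restrictLe n '' S, (Set.toFinite _).measurableSet, ?_⟩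
  refine Set.Subset.antisymm ?_ (Set.subset_preimage_image _ _)
  rintro y ⟨y', hy', hyy'⟩
  exact h y' y (fun i hi => congrFun hyy' ⟨i, hi⟩) hy'

/-- A code whose decision, at any time `n`, is a function of the first `n` outputs. -/
def Code.ofCausal [MeasurableSpace Y] [Finite Y] [MeasurableSingletonClass Y] {N : ℕ} (M : ℕ) (hM : 2 ≤ M) (c : Fin M → Fin N → X) (τ : (ℕ+ → Y) → ℕ+)
    (φ : (ℕ+ → Y) → Fin M)
    (h : ∀ y y' : ℕ+ → Y, (∀ i ≤ τ y, y i = y' i) → τ y' = τ y ∧ φ y' = φ y) : Code X Y N where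
  M := M
  two_le_M := hM
  codeword := c
  τ := τ
  isStoppingTime n := by
    refine measurableSet_piLE_of_forall fun y y' hyy' hy => ?_
    have hy : τ y ≤ n := WithTop.coe_le_coe.1 hy
    change (τ y' : WithTop ℕ+) ≤ n
    rw [(h y y' fun i hi => hyy' i (hi.trans hy)).1]
    exact WithTop.coe_le_coe.2 hy
  φ := φ
  measurable_φ := by
    intro U _
    have key : ∀ n : ℕ+, MeasurableSet[Filtration.piLE (X := fun _ : ℕ+ => Y) n]
        (φ ⁻¹' U ∩ {y | (τ y : WithTop ℕ+) ≤ n}) := by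
      refine fun n => measurableSet_piLE_of_forall fun y y' hyy' hy => ?_
      have hn : τ y ≤ n := WithTop.coe_le_coe.1 hy.2
      obtain ⟨h1, h2⟩ := h y y' fun i hi => hyy' i (hi.trans hn)
      refine ⟨(congrArg (· ∈ U) h2).mpr hy.1, ?_⟩
      change (τ y' : WithTop ℕ+) ≤ n
      rw [h1]
      exact hy.2
    refine ⟨?_, key⟩
    -- Measurability in the full product `σ`-algebra: `τ` is finite everywhere, so the pieces `τ ≤
    -- n` exhaust the space.
    have : φ ⁻¹' U = ⋃ n : ℕ+, φ ⁻¹' U ∩ {y | (τ y : WithTop ℕ+) ≤ n} := by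
      ext y
      simp only [Set.mem_iUnion, Set.mem_inter_iff]
      exact ⟨fun hy => ⟨τ y, hy, le_refl (τ y : WithTop ℕ+)⟩, fun ⟨_, hy, _⟩ => hy⟩
    rw [this]
    exact MeasurableSet.iUnion fun n =>
      le_iSup (Filtration.piLE (X := fun _ : ℕ+ => Y)) n _ (key n)

variable {N M : ℕ}

open Classical in
/-- The first start time of an accepted window, or `A` if there is none before. -/
noncomputable def firstAccept (A : ℕ) (T : Fin M → Set (Fin N → Y)) (y : ℕ+ → Y) : ℕ :=
  Nat.find (p := fun s => 1 ≤ s ∧ (A ≤ s ∨ ∃ m, window N s y ∈ T m))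
    -- `A + 1` rather than `A`, so that the search also terminates for `A = 0`.
    ⟨A + 1, by omega, Or.inl (by omega)⟩

open Classical in
/-- The message whose test accepts the window found by `firstAccept`. -/
noncomputable def acceptedMessage (A : ℕ) (T : Fin M → Set (Fin N → Y)) (m₀ : Fin M)
    (y : ℕ+ → Y) : Fin M :=
  if h : ∃ m, window N (firstAccept A T y) y ∈ T m then h.choose else m₀

lemma one_le_firstAccept (A : ℕ) (T : Fin M → Set (Fin N → Y)) (y : ℕ+ → Y) :
    1 ≤ firstAccept A T y := by
  classical
  exact (Nat.find_spec (p := fun s => 1 ≤ s ∧ (A ≤ s ∨ ∃ m, window N s y ∈ T m)) _).1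

lemma window_congr {y y' : ℕ+ → Y} {s n : ℕ} (hs : 1 ≤ s) (hsn : s ≤ n)
    (h : ∀ i ≤ (n + N - 1 : ℕ).toPNat', y i = y' i) : window N s y = window N s y' := by
  funext j
  have hj := j.2
  refine h _ (PNat.coe_le_coe _ _ |>.1 ?_)
  rw [coe_toPNat'_of_pos (by omega), coe_toPNat'_of_pos (by omega)]
  omega

/-- Causality: the search only reads windows starting up to the found time, hence outputs up to the
end of the last of them. -/
lemma firstAccept_congr {A : ℕ} {T : Fin M → Set (Fin N → Y)} {y y' : ℕ+ → Y}
    (h : ∀ i ≤ (firstAccept A T y + N - 1 : ℕ).toPNat', y i = y' i) :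
    firstAccept A T y' = firstAccept A T y := by
  classical
  have hw : ∀ s, 1 ≤ s → s ≤ firstAccept A T y → window N s y = window N s y' :=
    fun s hs hs' => window_congr hs hs' h
  have hspec : 1 ≤ firstAccept A T y ∧
      (A ≤ firstAccept A T y ∨ ∃ m, window N (firstAccept A T y) y ∈ T m) :=
    Nat.find_spec (p := fun s => 1 ≤ s ∧ (A ≤ s ∨ ∃ m, window N s y ∈ T m)) _
  refine (Nat.find_eq_iff _).2 ⟨⟨hspec.1, ?_⟩, fun n hn hn' => ?_⟩
  · rw [← hw _ hspec.1 le_rfl]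
    exact hspec.2
  · rw [← hw n hn'.1 hn.le] at hn'
    exact Nat.find_min _ hn hn'

lemma acceptedMessage_congr {A : ℕ} {T : Fin M → Set (Fin N → Y)} {m₀ : Fin M} {y y' : ℕ+ → Y}
    (h : ∀ i ≤ (firstAccept A T y + N - 1 : ℕ).toPNat', y i = y' i) :
    acceptedMessage A T m₀ y' = acceptedMessage A T m₀ y := by
  rw [acceptedMessage, acceptedMessage, firstAccept_congr h,
    ← window_congr (one_le_firstAccept A T y) le_rfl h]

/-- The code that stops at the end of the first window accepted by one of the tests `T m`. -/
noncomputable def sequentialCode [MeasurableSpace Y] [Finite Y] [MeasurableSingletonClass Y]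
    (A : ℕ) (hM : 2 ≤ M) (c : Fin M → Fin N → X) (T : Fin M → Set (Fin N → Y)) : Code X Y N :=
  Code.ofCausal M hM c (fun y => (firstAccept A T y + N - 1 : ℕ).toPNat')
    (acceptedMessage A T ⟨0, by omega⟩) fun _ _ h =>
      ⟨by simp only [firstAccept_congr h], acceptedMessage_congr h⟩

/-- If the window at `l ≤ A` passes the test of `m` and no test of another message accepts a window
starting in `{1, …, A}`, then the sequential decoder declares `m`. -/
lemma acceptedMessage_eq {A : ℕ} {T : Fin M → Set (Fin N → Y)} {m₀ m : Fin M} {y : ℕ+ → Y} {l : ℕ}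
    (hl : l ∈ Finset.Icc 1 A) (hm : window N l y ∈ T m)
    (hne : ∀ s ∈ Finset.Icc 1 A, ∀ m', m' ≠ m → window N s y ∉ T m') :
    acceptedMessage A T m₀ y = m := by
  classical
  rw [Finset.mem_Icc] at hl
  have hex : ∃ s, 1 ≤ s ∧ (A ≤ s ∨ ∃ m, window N s y ∈ T m) :=
    ⟨A + 1, by omega, Or.inl (by omega)⟩
  have hle : firstAccept A T y ≤ l := Nat.find_min' hex ⟨hl.1, Or.inr ⟨m, hm⟩⟩
  have h1 := one_le_firstAccept A T y
  have hspec : A ≤ firstAccept A T y ∨ ∃ m, window N (firstAccept A T y) y ∈ T m :=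
    (Nat.find_spec hex).2
  -- If the cap `A` ended the search, then `A ≤ firstAccept ≤ l ≤ A`, so the window found is the one
  -- at `l`, which passes.
  have hacc : ∃ m, window N (firstAccept A T y) y ∈ T m := by
    rcases hspec with h | h
    · have : firstAccept A T y = l := by omega
      exact ⟨m, this ▸ hm⟩
    · exact h
  rw [acceptedMessage, dif_pos hacc]
  by_contra hcon
  exact hne _ (Finset.mem_Icc.2 ⟨h1, by omega⟩) _ hcon hacc.choose_spec

end SequentialDecoder

/-! ### Averaging over independent random codewords. -/

section RandomCodebook

variable {C : Type*} [Fintype C] {M : ℕ}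

/-- Marginalisation: the weights of all codewords other than `c m` sum to `1`. -/
lemma sum_codebook_eq_sum {p : C → ℝ} (hp : ∑ u, p u = 1) (m : Fin M) (g : C → ℝ) :
    ∑ c : Fin M → C, (∏ k, p (c k)) * g (c m) = ∑ u, p u * g u := by
  classical
  have h := sum_prod_eq_prod_sum fun (k : Fin M) x => p x * if k = m then g x else 1
  simp_rw [Finset.prod_mul_distrib, Finset.prod_ite_eq', Finset.mem_univ, if_true] at h
  rw [h, Finset.prod_eq_single_of_mem m (Finset.mem_univ m)]
  · simp
  · intro k _ hk
    simp [hk, hp]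

/-- Distinct codewords are independent. This is checked on indicators of pairs of values, and `g` is
then expanded in these. -/
lemma sum_codebook_eq_sum_sum {p : C → ℝ} (hp : ∑ u, p u = 1) {m m' : Fin M} (hne : m ≠ m')
    (g : C → C → ℝ) : ∑ c : Fin M → C, (∏ k, p (c k)) * g (c m) (c m') =
      ∑ u, p u * ∑ v, p v * g u v := by
  classical
  have key : ∀ u v, ∑ c : Fin M → C, (∏ k, p (c k)) *
      ((if c m = u then 1 else 0) * if c m' = v then 1 else 0) = p u * p v := by
    intro u v
    have h := sum_prod_eq_prod_sum fun (k : Fin M) x =>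
      p x * ((if k = m then (if x = u then 1 else 0) else 1) *
        if k = m' then (if x = v then 1 else 0) else 1)
    simp_rw [Finset.prod_mul_distrib, Finset.prod_ite_eq', Finset.mem_univ, if_true] at h
    rw [h, Finset.prod_eq_mul m m' hne]
    · simp [hne, hne.symm]
    · rintro k - ⟨hk, hk'⟩
      simp [hk, hk', hp]
    · simp
    · simp
  have hg : ∀ c : Fin M → C, (∏ k, p (c k)) * g (c m) (c m') =
      ∑ u, ∑ v, (∏ k, p (c k)) *
        ((if c m = u then 1 else 0) * if c m' = v then 1 else 0) * g u v := by
    intro c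
    simp
  simp_rw [hg]
  rw [Finset.sum_comm]
  refine Finset.sum_congr rfl fun u _ => ?_
  rw [Finset.sum_comm, Finset.mul_sum]
  refine Finset.sum_congr rfl fun v _ => ?_
  rw [← Finset.sum_mul, key, mul_assoc]

/-- The random coding argument: with `M` independent codewords, some codebook performs at least as
well as the average. -/
lemma exists_codebook_le {p : C → ℝ} (hp0 : ∀ u, 0 ≤ p u) (hp : ∑ u, p u = 1) {b : C → ℝ}
    {e : C → C → ℝ} {κ₁ κ₂ : ℝ} (h₁ : ∑ u, p u * b u ≤ κ₁) (h₂ : ∀ u, ∑ v, p v * e u v ≤ κ₂)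
    (hκ : 0 ≤ κ₂) (hM : 0 < M) :
    ∃ c : Fin M → C,
      1 / (M : ℝ) * ∑ m, (b (c m) + ∑ m' ∈ Finset.univ.erase m, e (c m) (c m')) ≤
        κ₁ + M * κ₂ := by
  classical
  have hM' : (0 : ℝ) < M := by exact_mod_cast hM
  by_contra! hcon
  have hwt : ∑ c : Fin M → C, ∏ k, p (c k) = 1 := by
    rw [sum_prod_eq_prod_sum fun _ x => p x]; simp [hp]
  have hwt0 : ∀ c : Fin M → C, 0 ≤ ∏ k, p (c k) := fun c =>
    Finset.prod_nonneg fun k _ => hp0 _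
  -- A strict inequality between the averages needs one codebook of positive weight.
  obtain ⟨c₀, -, hc₀⟩ := Finset.exists_ne_zero_of_sum_ne_zero (hwt.trans_ne one_ne_zero)
  have hlt : ∑ c : Fin M → C, (∏ k, p (c k)) * (κ₁ + M * κ₂) <
      ∑ c : Fin M → C, (∏ k, p (c k)) *
        (1 / (M : ℝ) * ∑ m, (b (c m) + ∑ m' ∈ Finset.univ.erase m, e (c m) (c m'))) :=
    Finset.sum_lt_sum (fun c _ => mul_le_mul_of_nonneg_left (hcon c).le (hwt0 c))
      ⟨c₀, Finset.mem_univ _, mul_lt_mul_of_pos_left (hcon c₀) ((hwt0 c₀).lt_of_ne' hc₀)⟩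
  rw [← Finset.sum_mul, hwt, one_mul] at hlt
  refine hlt.not_ge ?_
  have hswap : ∑ c : Fin M → C, (∏ k, p (c k)) *
      (1 / (M : ℝ) * ∑ m, (b (c m) + ∑ m' ∈ Finset.univ.erase m, e (c m) (c m'))) =
      1 / (M : ℝ) * ∑ m : Fin M, (∑ u, p u * b u +
        ∑ m' ∈ Finset.univ.erase m, ∑ u, p u * ∑ v, p v * e u v) := by
    have hc : ∀ c : Fin M → C, (∏ k, p (c k)) *
        (1 / (M : ℝ) * ∑ m, (b (c m) + ∑ m' ∈ Finset.univ.erase m, e (c m) (c m'))) =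
        1 / (M : ℝ) * ∑ m, ((∏ k, p (c k)) * b (c m) +
          ∑ m' ∈ Finset.univ.erase m, (∏ k, p (c k)) * e (c m) (c m')) := by
      intro c
      rw [mul_left_comm, Finset.mul_sum]
      simp_rw [mul_add, Finset.mul_sum]
    simp_rw [hc]
    rw [← Finset.mul_sum, Finset.sum_comm]
    congr 1
    refine Finset.sum_congr rfl fun m _ => ?_
    rw [Finset.sum_add_distrib, sum_codebook_eq_sum hp, Finset.sum_comm]
    congr 1
    refine Finset.sum_congr rfl fun m' hm' => ?_
    exact sum_codebook_eq_sum_sum hp (Finset.ne_of_mem_erase hm').symm e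
  rw [hswap]
  have hpair : ∑ u, p u * ∑ v, p v * e u v ≤ κ₂ :=
    calc ∑ u, p u * ∑ v, p v * e u v ≤ ∑ u, p u * κ₂ :=
          Finset.sum_le_sum fun u _ => mul_le_mul_of_nonneg_left (h₂ u) (hp0 u)
      _ = κ₂ := by rw [← Finset.sum_mul, hp, one_mul]
  have hterm : ∀ m : Fin M, (∑ u, p u * b u +
      ∑ m' ∈ Finset.univ.erase m, ∑ u, p u * ∑ v, p v * e u v) ≤ κ₁ + M * κ₂ := by
    intro m
    refine add_le_add h₁ ?_
    refine (Finset.sum_le_card_nsmul _ _ κ₂ fun _ _ => hpair).trans ?_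
    rw [nsmul_eq_mul]
    refine mul_le_mul_of_nonneg_right ?_ hκ
    exact_mod_cast (Finset.card_le_univ _).trans (by simp)
  calc 1 / (M : ℝ) * ∑ m : Fin M, _ ≤ 1 / (M : ℝ) * ∑ m : Fin M, (κ₁ + M * κ₂) :=
        mul_le_mul_of_nonneg_left (Finset.sum_le_sum fun m _ => hterm m) (by positivity)
    _ = κ₁ + M * κ₂ := by
        rw [Finset.sum_const, Finset.card_univ, Fintype.card_fin, nsmul_eq_mul, one_div,
          inv_mul_cancel_left₀ hM'.ne']

end RandomCodebook

/-! ### Union bounds for the error of the sequential decoder. -/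

section Coding

variable {X Y : Type*} [Fintype Y] [MeasurableSpace Y] [MeasurableSingletonClass Y] {N : ℕ}

/-- The probability, averaged over the start time of the codeword `u`, that the test of the
codeword `v` accepts some window (with multiplicity). -/
noncomputable def falseAccept (Q : X → PMF Y) (star : X) (A : ℕ)
    (T : (Fin N → X) → Set (Fin N → Y)) (u v : Fin N → X) : ℝ :=
  1 / (A : ℝ) * ∑ l ∈ Finset.Icc 1 A, ∑ s ∈ Finset.Icc 1 A,
    (outputLaw Q star u l).real {y | window N s y ∈ T v}

/-- An error requires that the true window fails its own test or that the test of another message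
accepts somewhere. The test of `m` accepting at a wrong time is harmless, whence `Finset.univ.erase
m`. -/
lemma errorProb_sequentialCode_le (Q : X → PMF Y) (star : X) {A M : ℕ} (hA : 0 < A) (hM : 2 ≤ M)
    (c : Fin M → Fin N → X) (T : (Fin N → X) → Set (Fin N → Y)) :
    errorProb Q star A (sequentialCode A hM c fun m => T (c m)) ≤
      1 / (M : ℝ) * ∑ m, (wordWeight (fun j y => (Q (c m j) y).toReal) (T (c m))ᶜ +
        ∑ m' ∈ Finset.univ.erase m, falseAccept Q star A T (c m) (c m')) := by
  have hA' : (0 : ℝ) < A := by exact_mod_cast hA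
  change 1 / (A : ℝ) * (1 / (M : ℝ)) * ∑ m : Fin M, ∑ l ∈ Finset.Icc 1 A,
    (outputLaw Q star (c m) l).real
      {y | acceptedMessage A (fun m => T (c m)) ⟨0, by omega⟩ y ≠ m} ≤ _
  rw [mul_comm (1 / (A : ℝ)), mul_assoc, Finset.mul_sum]
  refine mul_le_mul_of_nonneg_left (Finset.sum_le_sum fun m _ => ?_) (by positivity)
  have hl : ∀ l ∈ Finset.Icc 1 A, (outputLaw Q star (c m) l).real
      {y | acceptedMessage A (fun m => T (c m)) ⟨0, by omega⟩ y ≠ m} ≤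
      wordWeight (fun j y => (Q (c m j) y).toReal) (T (c m))ᶜ +
        ∑ s ∈ Finset.Icc 1 A, ∑ m' ∈ Finset.univ.erase m,
          (outputLaw Q star (c m) l).real {y | window N s y ∈ T (c m')} := by
    intro l hl
    rw [← outputLaw_real_window_self Q star (c m) (Finset.mem_Icc.1 hl).1]
    have hsub : {y | acceptedMessage A (fun m => T (c m)) ⟨0, by omega⟩ y ≠ m} ⊆
        {y | window N l y ∈ (T (c m))ᶜ} ∪
          ⋃ s ∈ Finset.Icc 1 A, ⋃ m' ∈ Finset.univ.erase m, {y | window N s y ∈ T (c m')} := by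
      intro y hy
      by_contra hcon
      simp only [Set.mem_union, Set.mem_iUnion, not_or, not_exists] at hcon
      refine hy (acceptedMessage_eq hl (not_not.1 hcon.1) fun s hs m' hm' => ?_)
      exact hcon.2 s hs m' (Finset.mem_erase.2 ⟨hm', Finset.mem_univ _⟩)
    refine (measureReal_mono hsub).trans ((measureReal_union_le _ _).trans ?_)
    refine add_le_add le_rfl ((measureReal_biUnion_finset_le _ _).trans ?_)
    exact Finset.sum_le_sum fun s _ => measureReal_biUnion_finset_le _ _
  refine (mul_le_mul_of_nonneg_left (Finset.sum_le_sum hl) (by positivity)).trans (le_of_eq ?_)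
  rw [Finset.sum_add_distrib, mul_add, Finset.sum_const, Nat.card_Icc, Nat.add_sub_cancel,
    nsmul_eq_mul, one_div, inv_mul_cancel_left₀ hA'.ne']
  congr 1
  simp_rw [falseAccept, one_div, ← Finset.mul_sum]
  congr 1
  exact (Finset.sum_congr rfl fun l _ => Finset.sum_comm).trans Finset.sum_comm

/-- Windows disjoint from the transmitted codeword see pure noise and cost `κ₁` each. The others see
some product law mixing noise with a piece of `u`, which is why `h₂` is asked for arbitrary letter
laws; there are at most `2 * N` of them. -/
lemma sum_falseAccept_le [Fintype X] (Q : X → PMF Y) (star : X) {A : ℕ}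
    {p : (Fin N → X) → ℝ} (T : (Fin N → X) → Set (Fin N → Y)) (u : Fin N → X) {κ₁ κ₂ : ℝ}
    (hκ₁ : 0 ≤ κ₁) (hκ₂ : 0 ≤ κ₂)
    (h₁ : ∑ v, p v * wordWeight (fun _ y => (Q star y).toReal) (T v) ≤ κ₁)
    (h₂ : ∀ q : Fin N → PMF Y, ∑ v, p v * wordWeight (fun j y => (q j y).toReal) (T v) ≤ κ₂) :
    ∑ v, p v * falseAccept Q star A T u v ≤ A * κ₁ + 2 * N * κ₂ := by
  classical
  have hs : ∀ l ∈ Finset.Icc 1 A, ∑ s ∈ Finset.Icc 1 A, ∑ v, p v *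
      (outputLaw Q star u l).real {y | window N s y ∈ T v} ≤ A * κ₁ + 2 * N * κ₂ := by
    intro l _
    have hterm : ∀ s ∈ Finset.Icc 1 A, ∑ v, p v *
        (outputLaw Q star u l).real {y | window N s y ∈ T v} ≤
        -- With truncated subtraction, this interval is exactly the set of starts `s` at distance
        -- less than `N` from `l`.
        κ₁ + if s ∈ Finset.Ico (l + 1 - N) (l + N) then κ₂ else 0 := by
      intro s hs
      have hs1 := (Finset.mem_Icc.1 hs).1
      by_cases hd : s ∈ Finset.Ico (l + 1 - N) (l + N)
      · rw [if_pos hd]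
        simp_rw [outputLaw_real_window Q star u l hs1]
        exact (h₂ fun j => Q (inputAt star u l (s + j : ℕ).toPNat')).trans (by linarith)
      · rw [if_neg hd, add_zero]
        rw [Finset.mem_Ico] at hd
        simp_rw [outputLaw_real_window_of_disjoint Q star u hs1
          (show s + N ≤ l ∨ l + N ≤ s by omega)]
        exact h₁
    refine (Finset.sum_le_sum hterm).trans ?_
    rw [Finset.sum_add_distrib, Finset.sum_const, Nat.card_Icc, Nat.add_sub_cancel,
      nsmul_eq_mul, ← Finset.sum_filter, Finset.sum_const, nsmul_eq_mul]
    refine add_le_add le_rfl (mul_le_mul_of_nonneg_right ?_ hκ₂)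
    have hcard : (Finset.filter (· ∈ Finset.Ico (l + 1 - N) (l + N)) (Finset.Icc 1 A)).card ≤
        2 * N := by
      refine (Finset.card_le_card (t := Finset.Ico (l + 1 - N) (l + N)) fun s hs =>
        (Finset.mem_filter.1 hs).2).trans ?_
      rw [Nat.card_Ico]
      omega
    exact_mod_cast hcard
  have hrw : ∑ v, p v * falseAccept Q star A T u v = 1 / (A : ℝ) * ∑ l ∈ Finset.Icc 1 A,
      ∑ s ∈ Finset.Icc 1 A, ∑ v, p v *
        (outputLaw Q star u l).real {y | window N s y ∈ T v} := by
    simp_rw [falseAccept, mul_left_comm _ (1 / (A : ℝ)), ← Finset.mul_sum]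
    congr 1
    simp_rw [Finset.mul_sum]
    rw [Finset.sum_comm]
    exact Finset.sum_congr rfl fun l _ => Finset.sum_comm
  rw [hrw]
  rcases Nat.eq_zero_or_pos A with rfl | hA
  · simp only [Finset.Icc_eq_empty_of_lt zero_lt_one, Finset.sum_empty, mul_zero]
    positivity
  · have hA' : (0 : ℝ) < A := by exact_mod_cast hA
    refine (mul_le_mul_of_nonneg_left (Finset.sum_le_sum hs) (by positivity)).trans (le_of_eq ?_)
    rw [Finset.sum_const, Nat.card_Icc, Nat.add_sub_cancel, nsmul_eq_mul, one_div,
      inv_mul_cancel_left₀ hA'.ne']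

end Coding

/-! ### Score tests under i.i.d. random codewords. -/

section Ensemble

variable {X Y : Type*} [Fintype X] [Fintype Y] {N : ℕ}

lemma wordWeight_union_le {q : Fin N → Y → ℝ} (hq : ∀ j y, 0 ≤ q j y) (S T : Set (Fin N → Y)) :
    wordWeight q (S ∪ T) ≤ wordWeight q S + wordWeight q T := by
  rw [wordWeight, wordWeight, wordWeight, ← Finset.sum_add_distrib]
  refine Finset.sum_le_sum fun w _ => ?_
  have h0 : 0 ≤ ∏ j, q j (w j) := Finset.prod_nonneg fun j _ => hq j (w j)
  by_cases hS : w ∈ S <;> by_cases hT : w ∈ T <;> simp [hS, hT, h0]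

/-- For random input words the sum of the scores of the input-output pairs is at least any number
below its mean, up to an exponentially small probability. -/
lemma exists_sum_prod_mul_wordWeight_le (Q : X → PMF Y) {P : X → ℝ} (hP0 : ∀ x, 0 ≤ P x)
    (hP : ∑ x, P x = 1) (H : X → Y → ℝ) {θ : ℝ}
    (hθ : θ < ∑ x, P x * ∑ y, (Q x y).toReal * H x y) :
    ∃ ρ : ℝ, 0 < ρ ∧ ρ < 1 ∧ ∀ N : ℕ, ∑ u : Fin N → X, (∏ j, P (u j)) *
      wordWeight (fun j y => (Q (u j) y).toReal) {w | ∑ j, H (u j) (w j) < N * θ} ≤ ρ ^ N := by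
  -- A Chernoff bound for `θ - H` under the joint law of one input letter and its output, where its
  -- mean is negative.
  obtain ⟨t, ht, ρ, hρ0, hρ1, hρ⟩ := exists_exp_moment_lt_one (ι := Unit)
    (q := fun _ (a : X × Y) => P a.1 * (Q a.1 a.2).toReal)
    (fun _ => by
      simp_rw [Fintype.sum_prod_type, ← Finset.mul_sum, sum_toReal_pmf, mul_one, hP])
    (fun _ a => θ - H a.1 a.2)
    (fun _ => by
      simp_rw [Fintype.sum_prod_type, mul_sub, Finset.sum_sub_distrib, mul_assoc,
        ← Finset.mul_sum, ← Finset.sum_mul, sum_toReal_pmf, one_mul, ← Finset.sum_mul, hP,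
        one_mul]
      linarith)
  refine ⟨ρ, hρ0, hρ1, fun N => ?_⟩
  have hu : ∀ u : Fin N → X,
      wordWeight (fun j y => (Q (u j) y).toReal) {w | ∑ j, H (u j) (w j) < N * θ} ≤
        ∏ j, ∑ y, (Q (u j) y).toReal * Real.exp (t * (θ - H (u j) y)) := by
    intro u
    refine (wordWeight_le_exp (fun _ _ => ENNReal.toReal_nonneg)
      (fun j y => t * (θ - H (u j) y)) 0 fun w hw => ?_).trans (by simp)
    rw [← Finset.mul_sum, Finset.sum_sub_distrib, Finset.sum_const, Finset.card_univ,
      Fintype.card_fin, nsmul_eq_mul]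
    have hw : ∑ j, H (u j) (w j) < N * θ := hw
    exact mul_nonneg ht.le (by linarith)
  calc _ ≤ ∑ u : Fin N → X, (∏ j, P (u j)) *
        ∏ j, ∑ y, (Q (u j) y).toReal * Real.exp (t * (θ - H (u j) y)) :=
        Finset.sum_le_sum fun u _ => mul_le_mul_of_nonneg_left (hu u)
          (Finset.prod_nonneg fun j _ => hP0 _)
    _ = (∑ x, P x * ∑ y, (Q x y).toReal * Real.exp (t * (θ - H x y))) ^ N := by
        simp_rw [← Finset.prod_mul_distrib]
        rw [sum_prod_eq_prod_sum fun _ x =>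
          P x * ∑ y, (Q x y).toReal * Real.exp (t * (θ - H x y))]
        simp
    _ ≤ ρ ^ N := by
        refine pow_le_pow_left₀ (Finset.sum_nonneg fun x _ => mul_nonneg (hP0 x)
          (Finset.sum_nonneg fun y _ => by positivity)) ?_ N
        have := hρ ()
        simp_rw [Fintype.sum_prod_type, mul_assoc, ← Finset.mul_sum] at this
        exact this

lemma wordWeight_le_of_scores {q : Fin N → Y → ℝ} (hq : ∀ j y, 0 ≤ q j y) {h : Fin N → Y → ℝ}
    (hh : ∀ j, ∑ y, q j y * Real.exp (h j y) ≤ 1) {θ : ℝ} {S : Set (Fin N → Y)}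
    (hS : ∀ w ∈ S, θ ≤ ∑ j, h j (w j)) : wordWeight q S ≤ Real.exp (-θ) :=
  (wordWeight_le_exp hq h θ hS).trans <| mul_le_of_le_one_right (Real.exp_pos _).le <|
    Finset.prod_le_one (fun j _ => Finset.sum_nonneg fun y _ =>
      mul_nonneg (hq j y) (Real.exp_pos _).le) fun j _ => hh j

/-- Averaged over the random codeword `v`, a word drawn independently of `v` is rarely accepted. -/
lemma sum_prod_mul_wordWeight_le {P : X → ℝ} (hP0 : ∀ x, 0 ≤ P x) {q : Fin N → Y → ℝ}
    (hq : ∀ j y, 0 ≤ q j y) (hq1 : ∀ j, ∑ y, q j y = 1) {G : X → Y → ℝ}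
    (hG : ∀ y, ∑ x, P x * Real.exp (G x y) ≤ 1) {θ : ℝ} {T : (Fin N → X) → Set (Fin N → Y)}
    (hT : ∀ v, ∀ w ∈ T v, θ ≤ ∑ j, G (v j) (w j)) :
    ∑ v : Fin N → X, (∏ j, P (v j)) * wordWeight q (T v) ≤ Real.exp (-θ) := by
  classical
  -- Exchanging the sums freezes the output word `w` and leaves `v` random, so the exponential
  -- Markov inequality applies to `v`, with moments controlled by `hG`.
  have hswap : ∑ v : Fin N → X, (∏ j, P (v j)) * wordWeight q (T v) =
      ∑ w : Fin N → Y, (∏ j, q j (w j)) * wordWeight (fun _ => P) {v | w ∈ T v} := by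
    simp_rw [wordWeight, Finset.mul_sum]
    rw [Finset.sum_comm]
    refine Finset.sum_congr rfl fun w _ => Finset.sum_congr rfl fun v _ => ?_
    by_cases hw : w ∈ T v <;> simp [Set.indicator, hw, mul_comm]
  rw [hswap]
  calc _ ≤ ∑ w : Fin N → Y, (∏ j, q j (w j)) * Real.exp (-θ) :=
        Finset.sum_le_sum fun w _ => mul_le_mul_of_nonneg_left
          (wordWeight_le_of_scores (fun _ => hP0) (h := fun j x => G x (w j))
            (fun j => hG (w j)) fun v hv => hT v w hv)
          (Finset.prod_nonneg fun j _ => hq j _)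
    _ = Real.exp (-θ) := by
        rw [← Finset.sum_mul, sum_prod_eq_prod_sum q]
        simp [hq1]

end Ensemble

/-! ### Tools for the converse: change of measure and second moments. -/

/-- The density of an infinite product measure with respect to another one that differs from it in
finitely many factors. -/
lemma infinitePi_eq_withDensity {ι : Type*} {Ω : ι → Type*} [∀ i, MeasurableSpace (Ω i)]
    (μ ν : (i : ι) → Measure (Ω i)) [∀ i, IsProbabilityMeasure (μ i)]
    [∀ i, IsProbabilityMeasure (ν i)] (r : (i : ι) → Ω i → ℝ≥0∞) (hr : ∀ i, Measurable (r i))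
    (s₀ : Finset ι) (h₀ : ∀ i ∈ s₀, μ i = (ν i).withDensity (r i)) (h₁ : ∀ i ∉ s₀, μ i = ν i) :
    Measure.infinitePi μ = (Measure.infinitePi ν).withDensity fun y => ∏ i ∈ s₀, r i (y i) := by
  classical
  symm
  refine Measure.eq_infinitePi μ fun s t ht => ?_
  rw [withDensity_apply _ (MeasurableSet.pi s.countable_toSet fun i _ => ht i),
    ← lintegral_indicator (MeasurableSet.pi s.countable_toSet fun i _ => ht i)]
  -- The density times the indicator of a cylinder splits into one factor per coordinate, so its
  -- integral factors by independence.
  let g : (i : ι) → Ω i → ℝ≥0∞ := fun i =>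
    (if i ∈ s then t i else Set.univ).indicator (if i ∈ s₀ then r i else 1)
  have hset : ∀ i, MeasurableSet (if i ∈ s then t i else Set.univ) := fun i => by
    split_ifs
    exacts [ht i, MeasurableSet.univ]
  have hg : ∀ i, Measurable (g i) := fun i => by
    refine Measurable.indicator ?_ (hset i)
    split_ifs
    exacts [hr i, measurable_one]
  have hprod : ∀ y : (i : ι) → Ω i, ((s : Set ι).pi t).indicator
      (fun y => ∏ i ∈ s₀, r i (y i)) y = ∏ i ∈ s ∪ s₀, g i (y i) := by
    intro y
    by_cases hy : y ∈ (s : Set ι).pi t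
    · rw [Set.indicator_of_mem hy, ← Finset.prod_subset Finset.subset_union_right]
      · refine Finset.prod_congr rfl fun i hi => ?_
        simp only [g]
        rw [Set.indicator_of_mem, if_pos hi]
        split_ifs with his
        exacts [hy i his, Set.mem_univ _]
      · intro i hi hi0
        simp only [g]
        rw [Set.indicator_of_mem, if_neg hi0, Pi.one_apply]
        split_ifs with his
        exacts [hy i his, Set.mem_univ _]
    · rw [Set.indicator_of_notMem hy]
      simp only [Set.mem_pi, not_forall] at hy
      obtain ⟨i, hi, hyi⟩ := hy
      symm
      refine Finset.prod_eq_zero (Finset.mem_union_left _ (Finset.mem_coe.1 hi)) ?_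
      exact Set.indicator_of_notMem (by rwa [if_pos (Finset.mem_coe.1 hi)]) _
  rw [lintegral_congr hprod, lintegral_prod_eq_prod_lintegral_of_indepFun (s ∪ s₀)
    (fun i (y : (i : ι) → Ω i) => g i (y i)) (iIndepFun_infinitePi hg)
    fun i => (hg i).comp (measurable_pi_apply i)]
  have hint : ∀ i, ∫⁻ y, g i (y i) ∂Measure.infinitePi ν =
      μ i (if i ∈ s then t i else Set.univ) := by
    intro i
    rw [← lintegral_map (hg i) (measurable_pi_apply i), Measure.infinitePi_map_eval,
      lintegral_indicator (hset i)]
    by_cases hi : i ∈ s₀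
    · rw [if_pos hi, h₀ i hi, withDensity_apply _ (hset i)]
    · rw [if_neg hi, h₁ i hi]
      simp
  simp_rw [hint]
  rw [← Finset.prod_subset Finset.subset_union_left]
  · exact Finset.prod_congr rfl fun i hi => by rw [if_pos hi]
  · intro i _ hi
    rw [if_neg hi, measure_univ]

/-- The second moment method: the average of bounded variables that are independent at distance at
least `N` does not concentrate on small sets. -/
lemma sum_setIntegral_le {Ω : Type*} [MeasurableSpace Ω] (μ : Measure Ω) [IsProbabilityMeasure μ]
    {A N : ℕ} {T : ℝ} (hT : 0 ≤ T) {Z : ℕ → Ω → ℝ} (hZ : ∀ l, Measurable (Z l))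
    (h0 : ∀ l ω, 0 ≤ Z l ω) (hle : ∀ l ω, Z l ω ≤ T) (hint : ∀ l ∈ Finset.Icc 1 A, ∫ ω, Z l ω ∂μ ≤ 1)
    (hindep : ∀ l ∈ Finset.Icc 1 A, ∀ l' ∈ Finset.Icc 1 A, l + N ≤ l' ∨ l' + N ≤ l →
      IndepFun (Z l) (Z l') μ) {η : ℝ} (hη : 0 < η) (E : Set Ω) (hA : 0 < A) :
    ∑ l ∈ Finset.Icc 1 A, ∫ ω in E, Z l ω ∂μ ≤
      A * (μ.real E + η + 2 * N * T / (A * η)) := by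
  have hA' : (0 : ℝ) < A := by exact_mod_cast hA
  have hmem : ∀ l, MemLp (Z l) 2 μ := fun l =>
    MemLp.of_bound (hZ l).aestronglyMeasurable T (ae_of_all _ fun ω => by
      rw [Real.norm_of_nonneg (h0 l ω)]; exact hle l ω)
  have hZi : ∀ l, Integrable (Z l) μ := fun l => (hmem l).integrable (by norm_num)
  set S : Ω → ℝ := ∑ l ∈ Finset.Icc 1 A, Z l with hS
  have hSmem : MemLp S 2 μ := memLp_finsetSum' _ fun l _ => hmem l
  have hSi : Integrable S μ := hSmem.integrable (by norm_num)
  -- Nearby pairs satisfy `cov ≤ E[Z Z'] ≤ T * E[Z'] ≤ T`; the remaining pairs are independent.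
  have hcov : ∀ l ∈ Finset.Icc 1 A, ∀ l' ∈ Finset.Icc 1 A, cov[Z l, Z l'; μ] ≤
      if l' ∈ Finset.Ico (l + 1 - N) (l + N) then T else 0 := by
    intro l hl l' hl'
    by_cases hd : l' ∈ Finset.Ico (l + 1 - N) (l + N)
    · rw [if_pos hd, covariance_eq_sub (hmem l) (hmem l')]
      have h1 : 0 ≤ (∫ ω, Z l ω ∂μ) * ∫ ω, Z l' ω ∂μ :=
        mul_nonneg (integral_nonneg (h0 l)) (integral_nonneg (h0 l'))
      have h2 : ∫ ω, (Z l * Z l') ω ∂μ ≤ ∫ ω, T * Z l' ω ∂μ :=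
        integral_mono_of_nonneg (ae_of_all _ fun ω => mul_nonneg (h0 l ω) (h0 l' ω))
          ((hZi l').const_mul T)
          (ae_of_all _ fun ω => mul_le_mul_of_nonneg_right (hle l ω) (h0 l' ω))
      rw [integral_const_mul] at h2
      have h3 := mul_le_mul_of_nonneg_left (hint l' hl') hT
      linarith
    · rw [if_neg hd]
      rw [Finset.mem_Ico] at hd
      exact ((hindep l hl l' hl' (by omega)).covariance_eq_zero (hmem l) (hmem l')).le
  have hvar : Var[S; μ] ≤ A * (2 * N * T) := by
    rw [hS, variance_sum' fun l _ => hmem l]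
    have hrow : ∀ l ∈ Finset.Icc 1 A,
        ∑ l' ∈ Finset.Icc 1 A, cov[Z l, Z l'; μ] ≤ 2 * N * T := by
      intro l hl
      refine (Finset.sum_le_sum (hcov l hl)).trans ?_
      rw [← Finset.sum_filter, Finset.sum_const, nsmul_eq_mul]
      refine mul_le_mul_of_nonneg_right ?_ hT
      have hcard : (Finset.filter (· ∈ Finset.Ico (l + 1 - N) (l + N)) (Finset.Icc 1 A)).card ≤
          2 * N := by
        refine (Finset.card_le_card (t := Finset.Ico (l + 1 - N) (l + N)) fun s hs =>
          (Finset.mem_filter.1 hs).2).trans ?_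
        rw [Nat.card_Ico]
        omega
      exact_mod_cast hcard
    refine (Finset.sum_le_card_nsmul _ _ _ hrow).trans (le_of_eq ?_)
    rw [Nat.card_Icc, Nat.add_sub_cancel, nsmul_eq_mul]
  have hmean : ∫ ω, S ω ∂μ ≤ A := by
    simp_rw [hS, Finset.sum_apply]
    rw [integral_finsetSum _ fun l _ => hZi l]
    refine (Finset.sum_le_card_nsmul _ _ _ hint).trans (le_of_eq ?_)
    rw [Nat.card_Icc, Nat.add_sub_cancel, nsmul_eq_mul, mul_one]
  have hsq : Integrable (fun ω => (S ω - ∫ ω, S ω ∂μ) ^ 2) μ :=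
    (hSmem.sub (memLp_const _)).integrable_sq
  -- A pointwise substitute for Chebyshev's inequality: `x ≤ c + x ^ 2 / c` with `c = η * A`. The
  -- square integrates to the variance, and only the mean term is weighted by the measure of `E`.
  have hpt : ∀ ω, S ω ≤ (∫ ω, S ω ∂μ) +
      (η * A + (S ω - ∫ ω, S ω ∂μ) ^ 2 / (η * A)) := by
    intro ω
    have hpos : 0 < η * A := by positivity
    have key : ∀ x c : ℝ, 0 < c → x ≤ c + x ^ 2 / c := fun x c hc => by
      rw [← sub_nonneg, show c + x ^ 2 / c - x = ((c - x / 2) ^ 2 + 3 / 4 * x ^ 2) / c by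
        field_simp; ring]
      positivity
    linarith [key (S ω - ∫ ω, S ω ∂μ) _ hpos]
  have hgi : Integrable (fun ω => η * A + (S ω - ∫ ω, S ω ∂μ) ^ 2 / (η * A)) μ :=
    (integrable_const _).add (hsq.div_const _)
  calc ∑ l ∈ Finset.Icc 1 A, ∫ ω in E, Z l ω ∂μ = ∫ ω in E, S ω ∂μ := by
        simp_rw [hS, Finset.sum_apply]
        rw [integral_finsetSum _ fun l _ => (hZi l).integrableOn]
    _ ≤ ∫ ω in E, ((∫ ω, S ω ∂μ) + (η * A + (S ω - ∫ ω, S ω ∂μ) ^ 2 / (η * A))) ∂μ :=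
        integral_mono (μ := μ.restrict E) hSi.integrableOn
          ((integrable_const (∫ ω, S ω ∂μ)).add hgi.integrableOn) hpt
    _ = μ.real E * (∫ ω, S ω ∂μ) +
          ∫ ω in E, (η * A + (S ω - ∫ ω, S ω ∂μ) ^ 2 / (η * A)) ∂μ := by
        rw [integral_add (integrable_const _) hgi.integrableOn, setIntegral_const, smul_eq_mul]
    _ ≤ μ.real E * A + ∫ ω, (η * A + (S ω - ∫ ω, S ω ∂μ) ^ 2 / (η * A)) ∂μ := by
        refine add_le_add (mul_le_mul_of_nonneg_left hmean measureReal_nonneg)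
          (setIntegral_le_integral hgi (ae_of_all _ fun ω => ?_))
        have : 0 ≤ η * A + (S ω - ∫ ω, S ω ∂μ) ^ 2 / (η * A) := by positivity
        exact this
    _ = μ.real E * A + (η * A + Var[S; μ] / (η * A)) := by
        rw [integral_add (integrable_const _) (hsq.div_const _), integral_div,
          variance_eq_integral hSmem.aemeasurable]
        simp
    _ ≤ μ.real E * A + (η * A + A * (2 * N * T) / (η * A)) := by
        have : 0 < η * A := by positivity
        gcongr
    _ = A * (μ.real E + η + 2 * N * T / (A * η)) := by
        field_simp
        ring

/-! ### The converse: comparison of the averaged output law with pure noise. -/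

section Converse

/-- The likelihood ratio of a received word under the codeword `c` and under noise. -/
noncomputable def likelihoodRatio {X Y : Type*} {N : ℕ} (Q : X → PMF Y) (star : X)
    (c : Fin N → X) (w : Fin N → Y) : ℝ :=
  ∏ j, (Q (c j) (w j)).toReal / (Q star (w j)).toReal

lemma likelihoodRatio_nonneg {X Y : Type*} {N : ℕ} (Q : X → PMF Y) (star : X) (c : Fin N → X)
    (w : Fin N → Y) : 0 ≤ likelihoodRatio Q star c w :=
  Finset.prod_nonneg fun _ _ => by positivity

variable {X Y : Type*} [Fintype Y] [MeasurableSpace Y] [MeasurableSingletonClass Y] {N : ℕ}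

/-- The law of the outputs when only noise is transmitted. -/
noncomputable def noiseLaw (Q : X → PMF Y) (star : X) : Measure (ℕ+ → Y) :=
  Measure.infinitePi fun _ : ℕ+ => (Q star).toMeasure

instance (Q : X → PMF Y) (star : X) : IsProbabilityMeasure (noiseLaw Q star) := by
  unfold noiseLaw; infer_instance

lemma pmf_eq_withDensity (p q : PMF Y) (h : ∀ y, q y = 0 → p y = 0) :
    p.toMeasure = q.toMeasure.withDensity fun y => p y / q y := by
  refine Measure.ext_of_singleton fun y => ?_
  rw [withDensity_apply _ (measurableSet_singleton y), lintegral_singleton,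
    p.toMeasure_apply_singleton _ (measurableSet_singleton y),
    q.toMeasure_apply_singleton _ (measurableSet_singleton y)]
  by_cases hq : q y = 0
  · simp [hq, h y hq]
  · rw [ENNReal.div_mul_cancel hq (q.apply_ne_top y)]

/-- The two product laws can differ only in the `N` coordinates of the window at `l`, and `hQ` gives
absolute continuity in each of them. -/
lemma outputLaw_eq_withDensity {Q : X → PMF Y} {star : X}
    (hQ : ∀ x y, Q star y = 0 → Q x y = 0) (c : Fin N → X) {l : ℕ} (hl : 1 ≤ l) :
    outputLaw Q star c l = (noiseLaw Q star).withDensity fun y =>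
      ENNReal.ofReal (likelihoodRatio Q star c (window N l y)) := by
  classical
  have hne : ∀ x y, Q x y / Q star y ≠ ⊤ := by
    intro x y
    by_cases hy : Q star y = 0
    · simp [hy, hQ x y hy]
    · exact ENNReal.div_ne_top ((Q x).apply_ne_top y) hy
  rw [outputLaw, noiseLaw, infinitePi_eq_withDensity _ (fun _ : ℕ+ => (Q star).toMeasure)
    (fun i y => Q (inputAt star c l i) y / Q star y) (fun _ => measurable_of_finite _)
    (Finset.univ.image fun j : Fin N => (l + j : ℕ).toPNat')
    (fun i _ => pmf_eq_withDensity _ _ (hQ _)) fun i hi => ?_]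
  · congr 1
    funext y
    rw [Finset.prod_image fun i _ j _ h => window_injective hl h]
    simp_rw [inputAt_window_self star c hl]
    rw [likelihoodRatio, ENNReal.ofReal_prod_of_nonneg fun _ _ => by positivity]
    refine Finset.prod_congr rfl fun j _ => ?_
    rw [← ENNReal.toReal_div, ENNReal.ofReal_toReal (hne _ _)]
    rfl
  · congr 2
    rw [inputAt, dif_neg]
    intro h
    refine hi (Finset.mem_image.2 ⟨⟨(i : ℕ) - l, by omega⟩, Finset.mem_univ _, ?_⟩)
    refine PNat.coe_injective ?_
    simp only
    rw [coe_toPNat'_of_pos (by omega)]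
    omega

/-- The likelihood ratio, set to zero above the threshold `T`. -/
noncomputable def truncatedRatio (Q : X → PMF Y) (star : X) (T : ℝ) (c : Fin N → X)
    (w : Fin N → Y) : ℝ :=
  {w | likelihoodRatio Q star c w ≤ T}.indicator (likelihoodRatio Q star c) w

/-- Change of measure back to the output law; for `E = univ` it shows that the truncated ratio has
mean at most `1`. -/
lemma setIntegral_truncatedRatio {Q : X → PMF Y} {star : X}
    (hQ : ∀ x y, Q star y = 0 → Q x y = 0) (c : Fin N → X) {l : ℕ} (hl : 1 ≤ l) (T : ℝ)
    {E : Set (ℕ+ → Y)} (hE : MeasurableSet E) :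
    ∫ y in E, truncatedRatio Q star T c (window N l y) ∂noiseLaw Q star =
      (outputLaw Q star c l).real
        (E ∩ {y | likelihoodRatio Q star c (window N l y) ≤ T}) := by
  have hG : MeasurableSet {y : ℕ+ → Y | likelihoodRatio Q star c (window N l y) ≤ T} :=
    measurable_window l (Set.toFinite {w | likelihoodRatio Q star c w ≤ T}).measurableSet
  have hind : (fun y => truncatedRatio Q star T c (window N l y)) =
      {y | likelihoodRatio Q star c (window N l y) ≤ T}.indicator
        fun y => likelihoodRatio Q star c (window N l y) := rfl
  have hm : Measurable fun y => likelihoodRatio Q star c (window N l y) :=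
    (measurable_of_finite (likelihoodRatio Q star c)).comp (measurable_window l)
  rw [hind, setIntegral_indicator hG, outputLaw_eq_withDensity hQ c hl, measureReal_def,
    withDensity_apply _ (hE.inter hG), integral_eq_lintegral_of_nonneg_ae
      (ae_of_all _ fun y => likelihoodRatio_nonneg Q star c _) hm.aestronglyMeasurable]

lemma indepFun_window (Q : X → PMF Y) (star : X) {l l' : ℕ} (hl : 1 ≤ l) (hl' : 1 ≤ l')
    (h : l + N ≤ l' ∨ l' + N ≤ l) (f g : (Fin N → Y) → ℝ) :
    IndepFun (fun y => f (window N l y)) (fun y => g (window N l' y)) (noiseLaw Q star) := by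
  classical
  have hi : iIndepFun (fun (i : ℕ+) (y : ℕ+ → Y) => y i) (noiseLaw Q star) :=
    iIndepFun_infinitePi (X := fun _ y => y) fun _ => measurable_id
  let S : ℕ → Finset ℕ+ := fun l => Finset.univ.image fun j : Fin N => (l + j : ℕ).toPNat'
  have hdisj : Disjoint (S l) (S l') := by
    rw [Finset.disjoint_left]
    intro i hi hi'
    obtain ⟨j, -, rfl⟩ := Finset.mem_image.1 hi
    obtain ⟨j', -, hj⟩ := Finset.mem_image.1 hi'
    have := congrArg (fun n : ℕ+ => (n : ℕ)) hj
    simp only [coe_toPNat'_of_pos (show 0 < l' + (j' : ℕ) by omega),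
      coe_toPNat'_of_pos (show 0 < l + (j : ℕ) by omega)] at this
    omega
  have hmem : ∀ l (j : Fin N), (l + j : ℕ).toPNat' ∈ S l := fun l j =>
    Finset.mem_image_of_mem _ (Finset.mem_univ j)
  exact (hi.indepFun_finset (S l) (S l') hdisj fun i => measurable_pi_apply i).comp
    (φ := fun v : S l → Y => f fun j => v ⟨_, hmem l j⟩)
    (ψ := fun v : S l' → Y => g fun j => v ⟨_, hmem l' j⟩)
    (measurable_of_finite _) (measurable_of_finite _)

/-- Outcomes whose likelihood ratio exceeds `T` cost `κ`. On the rest, the output probability of `E`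
is the noise integral of a bounded ratio, and the second moment method bounds the average over `l`.
The correction is small once `A` is much larger than `N * T`. -/
lemma sum_outputLaw_le {Q : X → PMF Y} {star : X} (hQ : ∀ x y, Q star y = 0 → Q x y = 0)
    (c : Fin N → X) {A : ℕ} (hA : 0 < A) {T η κ : ℝ} (hT : 0 ≤ T) (hη : 0 < η)
    (hκ : wordWeight (fun j y => (Q (c j) y).toReal) {w | T < likelihoodRatio Q star c w} ≤ κ)
    {E : Set (ℕ+ → Y)} (hE : MeasurableSet E) :
    ∑ l ∈ Finset.Icc 1 A, (outputLaw Q star c l).real E ≤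
      A * ((noiseLaw Q star).real E + (κ + η + 2 * N * T / (A * η))) := by
  have hterm : ∀ l ∈ Finset.Icc 1 A, (outputLaw Q star c l).real E ≤
      κ + ∫ y in E, truncatedRatio Q star T c (window N l y) ∂noiseLaw Q star := by
    intro l hl
    have hl1 := (Finset.mem_Icc.1 hl).1
    rw [setIntegral_truncatedRatio hQ c hl1 T hE]
    have hsub : E ⊆ {y | window N l y ∈ {w | T < likelihoodRatio Q star c w}} ∪
        (E ∩ {y | likelihoodRatio Q star c (window N l y) ≤ T}) := by
      intro y hy
      rcases lt_or_ge T (likelihoodRatio Q star c (window N l y)) with h | h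
      exacts [Or.inl h, Or.inr ⟨hy, h⟩]
    refine (measureReal_mono hsub).trans ((measureReal_union_le _ _).trans ?_)
    rw [outputLaw_real_window_self Q star c hl1]
    exact add_le_add hκ le_rfl
  refine (Finset.sum_le_sum hterm).trans ?_
  have hmain := sum_setIntegral_le (noiseLaw Q star) (A := A) (N := N) hT
    (Z := fun l y => truncatedRatio Q star T c (window N l y))
    (fun l => (measurable_of_finite _).comp (measurable_window l))
    (fun l y => Set.indicator_nonneg (fun w _ => likelihoodRatio_nonneg Q star c w) _)
    (fun l y => Set.indicator_apply_le' (fun h => h) fun _ => hT)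
    (fun l hl => by
      rw [← setIntegral_univ, setIntegral_truncatedRatio hQ c (Finset.mem_Icc.1 hl).1 T
        MeasurableSet.univ]
      exact measureReal_le_one)
    (fun l hl l' hl' h => indepFun_window Q star (Finset.mem_Icc.1 hl).1
      (Finset.mem_Icc.1 hl').1 h _ _) hη E hA
  rw [Finset.sum_add_distrib, Finset.sum_const, Nat.card_Icc, Nat.add_sub_cancel, nsmul_eq_mul]
  linarith

/-- Under a transmitted codeword, the likelihood ratio exceeds `exp (N θ)` only with exponentially
small probability if `θ` is larger than all divergences from the noise law. -/
lemma exists_wordWeight_likelihoodRatio_le [Finite X] {Q : X → PMF Y} {star : X}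
    (hQ : ∀ x y, Q star y = 0 → Q x y = 0) {θ : ℝ}
    (hθ : ∀ x, (klDiv (Q x).toMeasure (Q star).toMeasure).toReal < θ) :
    ∃ ρ : ℝ, 0 < ρ ∧ ρ < 1 ∧ ∀ (N : ℕ) (c : Fin N → X),
      wordWeight (fun j y => (Q (c j) y).toReal)
        {w | Real.exp (N * θ) < likelihoodRatio Q star c w} ≤ ρ ^ N := by
  obtain ⟨t, ht, ρ, hρ0, hρ1, hρ⟩ := exists_exp_moment_lt_one
    (q := fun x y => (Q x y).toReal) (fun x => sum_toReal_pmf (Q x))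
    (fun x y => Real.log ((Q x y).toReal / (Q star y).toReal) - θ) (fun x => by
      simp_rw [mul_sub, Finset.sum_sub_distrib, ← Finset.sum_mul, sum_toReal_pmf, one_mul,
        sum_mul_log_eq_klDiv _ _ (hQ x)]
      linarith [hθ x])
  refine ⟨ρ, hρ0, hρ1, fun N c => ?_⟩
  refine (wordWeight_le_exp (fun _ _ => ENNReal.toReal_nonneg)
    (fun j y => t * (Real.log ((Q (c j) y).toReal / (Q star y).toReal) - θ)) 0
    fun w hw => ?_).trans ?_
  · have hw : Real.exp (N * θ) < ∏ j, (Q (c j) (w j)).toReal / (Q star (w j)).toReal := hw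
    -- On this event the product is positive, so no factor vanishes and the logarithm may be split.
    have hpos : ∏ j, (Q (c j) (w j)).toReal / (Q star (w j)).toReal ≠ 0 :=
      ((Real.exp_pos _).trans hw).ne'
    have hlog := Real.log_lt_log (Real.exp_pos _) hw
    rw [Real.log_exp, Real.log_prod fun j _ => Finset.prod_ne_zero_iff.1 hpos j
      (Finset.mem_univ j)] at hlog
    rw [← Finset.mul_sum, Finset.sum_sub_distrib, Finset.sum_const, Finset.card_univ,
      Fintype.card_fin, nsmul_eq_mul]
    exact mul_nonneg ht.le (by linarith)
  · rw [neg_zero, Real.exp_zero, one_mul]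
    refine (Finset.prod_le_prod (fun j _ => Finset.sum_nonneg fun y _ => by positivity)
      fun j _ => hρ (c j)).trans (by simp)

/-- With at least two messages, the error probability is at least `1 / 2` up to the distance of the
averaged output laws from the noise law. -/
lemma exists_le_errorProb [Finite X] {Q : X → PMF Y} {star : X}
    (hQ : ∀ x y, Q star y = 0 → Q x y = 0) {θ : ℝ}
    (hθ : ∀ x, (klDiv (Q x).toMeasure (Q star).toMeasure).toReal < θ) :
    ∃ ρ : ℝ, 0 < ρ ∧ ρ < 1 ∧ ∀ (N A : ℕ) (C : Code X Y N) (η : ℝ), 0 < A → 0 < η →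
      1 / 2 - (ρ ^ N + η + 2 * N * Real.exp (N * θ) / (A * η)) ≤ errorProb Q star A C := by
  obtain ⟨ρ, hρ0, hρ1, hρ⟩ := exists_wordWeight_likelihoodRatio_le hQ hθ
  refine ⟨ρ, hρ0, hρ1, fun N A C η hA hη => ?_⟩
  have hA' : (0 : ℝ) < A := by exact_mod_cast hA
  have hM : (2 : ℝ) ≤ C.M := by exact_mod_cast C.two_le_M
  set κ := ρ ^ N + η + 2 * N * Real.exp (N * θ) / (A * η) with hκ
  have hφ : ∀ m, MeasurableSet {y | C.φ y = m} := fun m =>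
    (C.isStoppingTime.measurableSpace_le) _ (C.measurable_φ (measurableSet_singleton m))
  have hm : ∀ m : Fin C.M, A * (1 - (noiseLaw Q star).real {y | C.φ y = m} - κ) ≤
      ∑ l ∈ Finset.Icc 1 A, (outputLaw Q star (C.codeword m) l).real {y | C.φ y ≠ m} := by
    intro m
    have hcompl : ∀ l, (outputLaw Q star (C.codeword m) l).real {y | C.φ y ≠ m} =
        1 - (outputLaw Q star (C.codeword m) l).real {y | C.φ y = m} := fun l =>
      probReal_compl_eq_one_sub (hφ m)
    simp_rw [hcompl]
    rw [Finset.sum_sub_distrib, Finset.sum_const, Nat.card_Icc, Nat.add_sub_cancel, nsmul_eq_mul]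
    have := sum_outputLaw_le hQ (C.codeword m) hA (Real.exp_pos _).le hη
      (hρ N (C.codeword m)) (hφ m)
    rw [← hκ] at this
    linarith
  -- Under noise the decisions partition the space, so a message is declared with probability `1 /
  -- M` on average.
  have hsum : ∑ m : Fin C.M, (noiseLaw Q star).real {y | C.φ y = m} = 1 := by
    have h1 := measureReal_biUnion_finset (μ := noiseLaw Q star) (s := Finset.univ)
      (f := fun m => {y | C.φ y = m})
      (fun m _ m' _ hne => Set.disjoint_left.2 fun y h h' =>
        hne (Eq.trans (Eq.symm h) h')) fun m _ => hφ m
    rw [← h1]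
    convert probReal_univ (μ := noiseLaw Q star)
    ext y
    simp
  rw [errorProb, mul_comm (1 / (A : ℝ)), mul_assoc]
  -- This uses `1 - 1 / M ≥ 1 / 2`, that is, `M ≥ 2`.
  calc 1 / 2 - κ ≤ 1 / (C.M : ℝ) * (C.M - 1 - C.M * κ) := by
        field_simp
        linarith
    _ = 1 / (C.M : ℝ) * (1 / (A : ℝ) *
          ∑ m : Fin C.M, A * (1 - (noiseLaw Q star).real {y | C.φ y = m} - κ)) := by
        rw [← Finset.mul_sum, one_div (A : ℝ), inv_mul_cancel_left₀ hA'.ne',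
          Finset.sum_sub_distrib, Finset.sum_sub_distrib, hsum]
        simp
    _ ≤ _ := by
        have hpos : (0 : ℝ) ≤ 1 / C.M := by positivity
        exact mul_le_mul_of_nonneg_left (mul_le_mul_of_nonneg_left
          (Finset.sum_le_sum fun m _ => hm m) (by positivity)) hpos

end Converse

/-! ### Asynchronism levels and achievability at rate zero. -/

lemma level_pos (a : ℝ) (N : ℕ) : 0 < level a N := Nat.ceil_pos.2 (Real.exp_pos _)

lemma exp_le_level (a : ℝ) (N : ℕ) : Real.exp (a * N) ≤ level a N := Nat.le_ceil _

lemma level_le {a : ℝ} (ha : 0 ≤ a) (N : ℕ) : (level a N : ℝ) ≤ 2 * Real.exp (a * N) := by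
  have h1 := Nat.ceil_lt_add_one (Real.exp_pos (a * N)).le
  have h2 : 1 ≤ Real.exp (a * N) := Real.one_le_exp (by positivity)
  unfold level
  linarith

lemma level_eq_of_nonpos {a : ℝ} (ha : a ≤ 0) (N : ℕ) : level a N = level 0 N := by
  have h1 : Real.exp (a * N) ≤ 1 :=
    Real.exp_le_one_iff.2 (mul_nonpos_of_nonpos_of_nonneg ha (Nat.cast_nonneg N))
  rw [level, level, zero_mul, Real.exp_zero, Nat.ceil_one]
  exact le_antisymm (Nat.ceil_le.2 (by simpa using h1)) (Nat.ceil_pos.2 (Real.exp_pos _))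

/-- The exponent `α - ε` may be negative; rounding up then gives level `1`, the same as for exponent
`0`. -/
lemma level_max_zero (a : ℝ) (N : ℕ) : level (max a 0) N = level a N := by
  rcases le_total a 0 with h | h
  · rw [max_eq_right h, level_eq_of_nonpos h]
  · rw [max_eq_left h]

/-- At rate `0` the demand is `rate ≥ ENNReal.ofReal (-ε) = 0`, which always holds, so only the
error probability matters. -/
lemma isAchievable_zero_of_forall_strategy {X Y : Type*} [MeasurableSpace Y]
    {Q : X → PMF Y} {star : X} {α : ℝ}
    (h : ∀ a : ℝ≥0, (a : ℝ) ≤ α → HasPositiveRateStrategy Q star a) (hα : 0 ≤ α) :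
    IsAchievable Q star α 0 := by
  intro ε hε N₀
  obtain ⟨C, hC, -⟩ := h ⟨max (α - ε) 0, le_max_right _ _⟩ (max_le (by linarith) hα)
  obtain ⟨N, hN, hle⟩ := ((hC.eventually (gt_mem_nhds hε)).and (eventually_ge_atTop N₀)).exists
  refine ⟨N, hle, C N, ?_, ?_⟩
  · rw [ENNReal.ofReal_of_nonpos (by linarith)]
    exact zero_le
  have hN : errorProb Q star (level (max (α - ε) 0) N) (C N) < ε := hN
  rw [level_max_zero] at hN
  exact hN.le

/-! ### Construction of the codes and evaluation of the threshold. -/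

section Achievability

/-- Two different input laws can be told apart by a score against their mixture. -/
lemma exists_score_of_ne {Y : Type*} [Fintype Y] (p q : PMF Y) (hpq : p ≠ q) {δ : ℝ}
    (hδ0 : 0 < δ) (hδ1 : δ < 1) :
    ∃ g h : Y → ℝ, (∀ y, (1 - δ) * Real.exp (g y) + δ * Real.exp (h y) ≤ 1) ∧
      0 < (1 - δ) * ∑ y, (p y).toReal * g y + δ * ∑ y, (q y).toReal * h y := by
  classical
  obtain ⟨y₀, hy₀⟩ : ∃ y, (q y).toReal < (p y).toReal := by
    by_contra! hle
    refine hpq (PMF.ext fun y => ?_)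
    have := (Finset.sum_eq_sum_iff_of_le fun y _ => hle y).1
      ((sum_toReal_pmf p).trans (sum_toReal_pmf q).symm) y (Finset.mem_univ y)
    exact (ENNReal.toReal_eq_toReal_iff' (p.apply_ne_top y) (q.apply_ne_top y)).1 this
  set d := (p y₀).toReal - (q y₀).toReal with hd
  have hd0 : 0 < d := by linarith
  -- The bound on `t` makes the first-order gain `t * (1 - δ) * δ * d` exceed the second-order loss
  -- `t ^ 2`.
  obtain ⟨t, ht0, ht1, htd⟩ : ∃ t : ℝ, 0 < t ∧ t ≤ 1 ∧ t < (1 - δ) * δ * d := by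
    have hpos : 0 < (1 - δ) * δ * d := mul_pos (mul_pos (by linarith) hδ0) hd0
    exact ⟨min 1 ((1 - δ) * δ * d / 2), lt_min one_pos (by linarith), min_le_left _ _,
      (min_le_right _ _).trans_lt (by linarith)⟩
  have hexp : ∀ v : ℝ, |v| ≤ t → Real.exp (v - t ^ 2) ≤ (1 + v + t ^ 2) * Real.exp (-t ^ 2) := by
    intro v hv
    rw [sub_eq_add_neg, Real.exp_add]
    refine mul_le_mul_of_nonneg_right ?_ (Real.exp_pos _).le
    have h1 := (abs_le.1 (Real.abs_exp_sub_one_sub_id_le (hv.trans ht1))).2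
    have h2 : v ^ 2 ≤ t ^ 2 := sq_le_sq' (by linarith [(abs_le.1 hv).1]) (abs_le.1 hv).2
    linarith
  have hnorm : (1 + t ^ 2) * Real.exp (-t ^ 2) ≤ 1 := by
    rw [Real.exp_neg, ← div_eq_mul_inv, div_le_one (Real.exp_pos _)]
    linarith [Real.add_one_le_exp (t ^ 2)]
  -- The values `t * δ` and `-(t * (1 - δ))` cancel to first order in the mixture; the shift by `t ^
  -- 2` absorbs the second-order term of the exponential.
  refine ⟨fun y => (if y = y₀ then t * δ else 0) - t ^ 2,
    fun y => (if y = y₀ then -(t * (1 - δ)) else 0) - t ^ 2, fun y => ?_, ?_⟩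
  · have h1 := hexp (if y = y₀ then t * δ else 0) (by
      split_ifs
      · rw [abs_of_pos (by positivity)]; nlinarith
      · simpa using ht0.le)
    have h2 := hexp (if y = y₀ then -(t * (1 - δ)) else 0) (by
      split_ifs
      · rw [abs_neg, abs_of_nonneg (mul_nonneg ht0.le (by linarith))]; nlinarith
      · simpa using ht0.le)
    refine (add_le_add (mul_le_mul_of_nonneg_left h1 (by linarith : 0 ≤ 1 - δ))
      (mul_le_mul_of_nonneg_left h2 hδ0.le)).trans (le_trans (le_of_eq ?_) hnorm)
    split_ifs <;> ring
  · simp_rw [mul_sub, Finset.sum_sub_distrib, ← Finset.sum_mul, sum_toReal_pmf, mul_ite, mul_zero,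
      Finset.sum_ite_eq', Finset.mem_univ, if_true]
    refine (mul_pos ht0 (sub_pos.2 htd)).trans_eq ?_
    rw [hd]
    ring

variable {X Y : Type*} [Fintype X] [Fintype Y] [MeasurableSpace Y] [MeasurableSingletonClass Y]

/-- Random coding with two scores: `F` separates the input symbols from noise, and `G` separates
the transmitted codeword from independent ones. -/
lemma exists_code_errorProb_le (Q : X → PMF Y) (star : X) {P : X → ℝ} (hP0 : ∀ x, 0 ≤ P x)
    (hP : ∑ x, P x = 1) {F G : X → Y → ℝ}
    (hF : ∀ x, ∑ y, (Q star y).toReal * Real.exp (F x y) ≤ 1)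
    (hG : ∀ y, ∑ x, P x * Real.exp (G x y) ≤ 1) {θ₁ θ₂ ρ₁ ρ₂ : ℝ} {N : ℕ}
    (hρ₁ : ∑ u : Fin N → X, (∏ j, P (u j)) *
      wordWeight (fun j y => (Q (u j) y).toReal) {w | ∑ j, F (u j) (w j) < N * θ₁} ≤ ρ₁)
    (hρ₂ : ∑ u : Fin N → X, (∏ j, P (u j)) *
      wordWeight (fun j y => (Q (u j) y).toReal) {w | ∑ j, G (u j) (w j) < N * θ₂} ≤ ρ₂)
    {A M : ℕ} (hA : 0 < A) (hM : 2 ≤ M) :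
    ∃ C : Code X Y N, C.M = M ∧ errorProb Q star A C ≤ ρ₁ + ρ₂ +
      M * (A * Real.exp (-(N * θ₁)) + 2 * N * Real.exp (-(N * θ₂))) := by
  let T : (Fin N → X) → Set (Fin N → Y) := fun u =>
    {w | N * θ₁ ≤ ∑ j, F (u j) (w j) ∧ N * θ₂ ≤ ∑ j, G (u j) (w j)}
  have hp0 : ∀ u : Fin N → X, 0 ≤ ∏ j, P (u j) := fun u => Finset.prod_nonneg fun j _ => hP0 _
  have hp1 : ∑ u : Fin N → X, ∏ j, P (u j) = 1 := by
    rw [sum_prod_eq_prod_sum fun _ x => P x]; simp [hP]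
  have hmiss : ∑ u : Fin N → X, (∏ j, P (u j)) *
      wordWeight (fun j y => (Q (u j) y).toReal) (T u)ᶜ ≤ ρ₁ + ρ₂ := by
    refine le_trans ?_ (add_le_add hρ₁ hρ₂)
    rw [← Finset.sum_add_distrib]
    refine Finset.sum_le_sum fun u _ => ?_
    rw [← mul_add]
    refine mul_le_mul_of_nonneg_left ?_ (hp0 u)
    have hT : (T u)ᶜ = {w | ∑ j, F (u j) (w j) < N * θ₁} ∪
        {w | ∑ j, G (u j) (w j) < N * θ₂} := by
      ext w
      simp only [T, Set.mem_compl_iff, Set.mem_ofPred_eq, Set.mem_union, not_and_or, not_le]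
    rw [hT]
    exact wordWeight_union_le (fun _ _ => ENNReal.toReal_nonneg) _ _
  have hnoise : ∑ v : Fin N → X, (∏ j, P (v j)) *
      wordWeight (fun _ y => (Q star y).toReal) (T v) ≤ Real.exp (-(N * θ₁)) :=
    calc _ ≤ ∑ v : Fin N → X, (∏ j, P (v j)) * Real.exp (-(N * θ₁)) :=
          Finset.sum_le_sum fun v _ => mul_le_mul_of_nonneg_left
            (wordWeight_le_of_scores (fun _ _ => ENNReal.toReal_nonneg)
              (fun j => hF (v j)) fun w hw => hw.1) (hp0 v)
      _ = Real.exp (-(N * θ₁)) := by rw [← Finset.sum_mul, hp1, one_mul]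
  obtain ⟨c, hc⟩ := exists_codebook_le (M := M) hp0 hp1 hmiss
    (fun u => sum_falseAccept_le Q star (A := A) T u (Real.exp_pos _).le (Real.exp_pos _).le
      hnoise fun q => sum_prod_mul_wordWeight_le hP0 (fun _ _ => ENNReal.toReal_nonneg)
        (fun j => sum_toReal_pmf (q j)) hG fun v w hw => hw.2)
    (by positivity) (by omega)
  exact ⟨sequentialCode A hM c fun m => T (c m), rfl,
    (errorProb_sequentialCode_le Q star hA hM c T).trans hc⟩

/-- With about `exp (r N)` messages and thresholds `θ₁ = a + 2 * r`, `θ₂ = 2 * r`, both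
false-acceptance terms are `exp (-r N)` up to a factor linear in `N`. -/
lemma hasPositiveRateStrategy_of_scores (Q : X → PMF Y) (star : X) {P : X → ℝ}
    (hP0 : ∀ x, 0 ≤ P x) (hP : ∑ x, P x = 1) {F G : X → Y → ℝ}
    (hF : ∀ x, ∑ y, (Q star y).toReal * Real.exp (F x y) ≤ 1)
    (hG : ∀ y, ∑ x, P x * Real.exp (G x y) ≤ 1) {a : ℝ} (ha : 0 ≤ a)
    (haF : a < ∑ x, P x * ∑ y, (Q x y).toReal * F x y)
    (hG0 : 0 < ∑ x, P x * ∑ y, (Q x y).toReal * G x y) :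
    HasPositiveRateStrategy Q star a := by
  obtain ⟨r, hr0, hrF, hrG⟩ : ∃ r : ℝ, 0 < r ∧
      a + 2 * r < ∑ x, P x * ∑ y, (Q x y).toReal * F x y ∧
      2 * r < ∑ x, P x * ∑ y, (Q x y).toReal * G x y := by
    obtain ⟨s, hs0, hs⟩ := exists_between (lt_min (sub_pos.2 haF) hG0)
    exact ⟨s / 2, by linarith, by linarith [hs.trans_le (min_le_left _ _)],
      by linarith [hs.trans_le (min_le_right _ _)]⟩
  obtain ⟨ρ₁, hρ₁0, hρ₁1, hρ₁⟩ := exists_sum_prod_mul_wordWeight_le Q hP0 hP F hrF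
  obtain ⟨ρ₂, hρ₂0, hρ₂1, hρ₂⟩ := exists_sum_prod_mul_wordWeight_le Q hP0 hP G hrG
  have hM1 : ∀ N : ℕ, 1 ≤ Real.exp (r * N) := fun N => Real.one_le_exp (by positivity)
  -- The extra `1` guarantees two messages for every `N`, including `N = 0`.
  let M : ℕ → ℕ := fun N => ⌈Real.exp (r * N)⌉₊ + 1
  have hM2 : ∀ N, 2 ≤ M N := fun N => by
    have : 0 < ⌈Real.exp (r * N)⌉₊ := Nat.ceil_pos.2 (Real.exp_pos _)
    simp only [M]
    omega
  have hMlo : ∀ N : ℕ, Real.exp (r * N) ≤ M N := fun N => by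
    have := Nat.le_ceil (Real.exp (r * N))
    simp only [M]
    push_cast
    linarith
  have hMhi : ∀ N, (M N : ℝ) ≤ 3 * Real.exp (r * N) := fun N => by
    have := Nat.ceil_lt_add_one (Real.exp_pos (r * N)).le
    simp only [M]
    push_cast
    linarith [hM1 N]
  choose C hCM hC using fun N => exists_code_errorProb_le Q star hP0 hP hF hG (hρ₁ N) (hρ₂ N)
    (level_pos a N) (hM2 N)
  refine ⟨C, ?_, r, hr0, ?_⟩
  · have hq0 : 0 ≤ Real.exp (-r) := (Real.exp_pos _).le
    have hq1 : Real.exp (-r) < 1 := Real.exp_lt_one_iff.2 (by linarith)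
    have hlim : Tendsto (fun N : ℕ => ρ₁ ^ N + ρ₂ ^ N +
        (6 * Real.exp (-r) ^ N + 6 * (N * Real.exp (-r) ^ N))) atTop (𝓝 0) := by
      simpa using ((tendsto_pow_atTop_nhds_zero_of_lt_one hρ₁0.le hρ₁1).add
        (tendsto_pow_atTop_nhds_zero_of_lt_one hρ₂0.le hρ₂1)).add
        (((tendsto_pow_atTop_nhds_zero_of_lt_one hq0 hq1).const_mul 6).add
          ((tendsto_self_mul_const_pow_of_lt_one hq0 hq1).const_mul 6))
    refine squeeze_zero (fun N => ?_) (fun N => ?_) hlim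
    · unfold errorProb
      positivity
    · refine (hC N).trans (add_le_add le_rfl ?_)
      calc (M N : ℝ) * (level a N * Real.exp (-(N * (a + 2 * r))) +
            2 * N * Real.exp (-(N * (2 * r)))) ≤
          3 * Real.exp (r * N) * (2 * Real.exp (a * N) * Real.exp (-(N * (a + 2 * r))) +
            2 * N * Real.exp (-(N * (2 * r)))) := by
            gcongr
            exacts [hMhi N, level_le ha N]
        _ = 6 * (Real.exp (r * N) * Real.exp (a * N) * Real.exp (-(N * (a + 2 * r)))) +
            6 * (N * (Real.exp (r * N) * Real.exp (-(N * (2 * r))))) := by ring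
        _ = _ := by
            rw [← Real.exp_add, ← Real.exp_add, ← Real.exp_add, ← Real.exp_nat_mul]
            ring_nf
  · have hlo : ∀ N : ℕ, r * N ≤ Real.log (M N) := fun N => by
      rw [← Real.log_exp (r * N)]
      exact Real.log_le_log (Real.exp_pos _) (hMlo N)
    have hhi : ∀ N : ℕ, Real.log (M N) ≤ Real.log 3 + r * N := fun N => by
      rw [← Real.log_exp (r * N), ← Real.log_mul (by norm_num) (Real.exp_pos _).ne']
      exact Real.log_le_log ((Real.exp_pos _).trans_le (hMlo N)) (by simpa using hMhi N)
    have hupper : Tendsto (fun N : ℕ => Real.log 3 / N + r) atTop (𝓝 r) := by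
      simpa using (tendsto_const_div_atTop_nhds_zero_nat (Real.log 3)).add_const r
    refine tendsto_of_tendsto_of_tendsto_of_le_of_le' tendsto_const_nhds hupper ?_ ?_
    · filter_upwards [eventually_gt_atTop 0] with N hN
      have hN' : (0 : ℝ) < N := by exact_mod_cast hN
      rw [hCM, le_div_iff₀ hN']
      exact hlo N
    · filter_upwards [eventually_gt_atTop 0] with N hN
      have hN' : (0 : ℝ) < N := by exact_mod_cast hN
      rw [hCM, div_add' _ _ _ hN'.ne', div_le_div_iff_of_pos_right hN']
      exact hhi N

/-- A fraction `δ` of noise symbols makes the codewords random. The positions with `star` say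
nothing against noise, so `F` vanishes there and its mean only drops from `μ` to `(1 - δ) * μ`. -/
lemma hasPositiveRateStrategy_of_lt_klDiv (Q : X → PMF Y) (star x : X) {a : ℝ≥0}
    (ha : (a : ℝ≥0∞) < klDiv (Q x).toMeasure (Q star).toMeasure) :
    HasPositiveRateStrategy Q star a := by
  classical
  have hne : Q x ≠ Q star := fun h => by simp [h] at ha
  have hx : x ≠ star := fun h => hne (congrArg Q h)
  obtain ⟨f, haf, hf⟩ := exists_potential_of_lt_klDiv (Q x) (Q star) ha
  set μ := ∑ y, (Q x y).toReal * f y with hμ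
  have ha0 : (0 : ℝ) ≤ a := a.2
  have hμ0 : 0 < μ := by linarith
  obtain ⟨δ, hδ0, hδ1, hδ⟩ : ∃ δ : ℝ, 0 < δ ∧ δ < 1 ∧ a < (1 - δ) * μ := by
    -- With this `δ`, `(1 - δ) * μ` is the midpoint of `a` and `μ`.
    refine ⟨(μ - a) / (2 * μ), div_pos (by linarith) (by linarith), ?_, ?_⟩
    · rw [div_lt_one (by linarith)]; linarith
    · have : (1 - (μ - a) / (2 * μ)) * μ = (μ + a) / 2 := by field_simp; ring
      linarith
  obtain ⟨g, h, hgh, hgh0⟩ := exists_score_of_ne _ _ hne hδ0 hδ1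
  let P : X → ℝ := fun z => (if z = x then 1 - δ else 0) + if z = star then δ else 0
  have hPsum : ∀ k : X → ℝ, ∑ z, P z * k z = (1 - δ) * k x + δ * k star := fun k => by
    simp [P, add_mul, Finset.sum_add_distrib]
  refine hasPositiveRateStrategy_of_scores Q star (P := P)
    (F := fun z y => if z = x then f y else 0) (G := fun z y => if z = x then g y else h y)
    (fun z => ?_) ?_ (fun z => ?_) (fun y => ?_) ha0 ?_ ?_
  · have : 0 ≤ 1 - δ := by linarith
    simp only [P]
    positivity
  · have := hPsum fun _ => 1
    simp only [mul_one] at this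
    linarith
  · by_cases hz : z = x
    · simpa [hz] using hf
    · simp [hz, sum_toReal_pmf]
  · rw [hPsum fun z => Real.exp (if z = x then g y else h y), if_pos rfl, if_neg hx.symm]
    exact hgh y
  · rw [hPsum fun z => ∑ y, (Q z y).toReal * if z = x then f y else 0]
    simpa [hx.symm] using hδ
  · rw [hPsum fun z => ∑ y, (Q z y).toReal * if z = x then g y else h y]
    simpa [hx.symm] using hgh0

lemma isAchievable_zero_of_lt_klDiv (Q : X → PMF Y) (star x : X) {α : ℝ≥0}
    (hα : (α : ℝ≥0∞) < klDiv (Q x).toMeasure (Q star).toMeasure) :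
    IsAchievable Q star α 0 :=
  isAchievable_zero_of_forall_strategy (fun _ ha => hasPositiveRateStrategy_of_lt_klDiv Q star x
    ((ENNReal.coe_le_coe.2 (NNReal.coe_le_coe.1 ha)).trans_lt hα)) α.2

lemma le_of_isAchievable_zero {Q : X → PMF Y} {star : X} {D : ℝ≥0}
    (hD : ∀ x, klDiv (Q x).toMeasure (Q star).toMeasure ≤ D) {α : ℝ≥0}
    (hα : IsAchievable Q star α 0) : α ≤ D := by
  by_contra! hlt
  have hfin : ∀ x, klDiv (Q x).toMeasure (Q star).toMeasure ≠ ⊤ := fun x =>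
    ne_top_of_le_ne_top ENNReal.coe_ne_top (hD x)
  have hlt' : (D : ℝ) < α := hlt
  -- Since `ε ≤ γ`, the level exponent is at least `D + 3 * γ`, while the truncation exponent is `D
  -- + γ`; the gap `2 * γ` drives the decay. With `η = 1 / 8` the error exceeds `1 / 2 - 1 / 8 - 1 /
  -- 8`, hence `ε ≤ 1 / 8`.
  set γ : ℝ := (α - D) / 4 with hγ
  have hγ0 : 0 < γ := by linarith
  obtain ⟨ρ, hρ0, hρ1, hρ⟩ := exists_le_errorProb (Q := Q) (star := star) (θ := D + γ)
    (fun x => (klDiv_pmf_ne_top_iff (Q x) (Q star)).1 (hfin x)) fun x => by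
      have := ENNReal.toReal_mono ENNReal.coe_ne_top (hD x)
      rw [ENNReal.coe_toReal] at this
      linarith
  have hlim : Tendsto (fun N : ℕ => ρ ^ N + 16 * (N * Real.exp (-(2 * γ)) ^ N)) atTop (𝓝 0) := by
    simpa using (tendsto_pow_atTop_nhds_zero_of_lt_one hρ0.le hρ1).add
      ((tendsto_self_mul_const_pow_of_lt_one (Real.exp_pos _).le
        (Real.exp_lt_one_iff.2 (by linarith : -(2 * γ) < 0))).const_mul 16)
  obtain ⟨N₀, hN₀⟩ := eventually_atTop.1
    (hlim.eventually (gt_mem_nhds (by norm_num : (0 : ℝ) < 1 / 8)))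
  set ε : ℝ := min γ (1 / 8)
  obtain ⟨N, hN, C, -, hC⟩ := hα ε (lt_min hγ0 (by norm_num)) N₀
  have h1 := hρ N (level (α - ε) N) C (1 / 8) (level_pos _ _) (by norm_num)
  have h2 := hN₀ N hN
  have h3 : 2 * N * Real.exp (N * (D + γ)) / (level (α - ε) N * (1 / 8)) ≤
      16 * (N * Real.exp (-(2 * γ)) ^ N) := by
    have hlev : Real.exp (N * (D + 3 * γ)) ≤ level (α - ε) N := by
      refine le_trans (Real.exp_le_exp.2 ?_) (exp_le_level _ _)
      rw [mul_comm]
      refine mul_le_mul_of_nonneg_right ?_ (Nat.cast_nonneg N)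
      have : ε ≤ γ := min_le_left _ _
      linarith
    calc 2 * N * Real.exp (N * (D + γ)) / (level (α - ε) N * (1 / 8)) ≤
        2 * N * Real.exp (N * (D + γ)) / (Real.exp (N * (D + 3 * γ)) * (1 / 8)) := by
          gcongr
      _ = 16 * (N * (Real.exp (N * (D + γ)) / Real.exp (N * (D + 3 * γ)))) := by
          field_simp; ring
      _ = _ := by
          rw [← Real.exp_sub, ← Real.exp_nat_mul]
          ring_nf
  have h4 : ε ≤ 1 / 8 := min_le_right _ _
  linarith

lemma synchronizationThreshold_eq (Q : X → PMF Y) (star x : X)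
    (hx : ∀ z, klDiv (Q z).toMeasure (Q star).toMeasure ≤
      klDiv (Q x).toMeasure (Q star).toMeasure) :
    synchronizationThreshold Q star = klDiv (Q x).toMeasure (Q star).toMeasure := by
  refine le_antisymm (iSup₂_le fun α hα => ?_) (ENNReal.le_of_forall_nnreal_lt fun α hα => ?_)
  -- An infinite maximum needs no converse; a finite one supplies the absolute continuity that the
  -- converse relies on.
  · by_cases htop : klDiv (Q x).toMeasure (Q star).toMeasure = ⊤
    · exact htop ▸ le_top
    · lift klDiv (Q x).toMeasure (Q star).toMeasure to ℝ≥0 using htop with D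
      exact ENNReal.coe_le_coe.2 (le_of_isAchievable_zero hx hα)
  · exact le_iSup₂ (f := fun (α : ℝ≥0) (_ : IsAchievable Q star α 0) => (α : ℝ≥0∞)) α
      (isAchievable_zero_of_lt_klDiv Q star x hα)

end Achievability

end AsyncComm

theorem theorem1 {X Y : Type*} [Fintype X] [Fintype Y] [MeasurableSpace Y]
    [MeasurableSingletonClass Y] (Q : X → PMF Y) (star : X) :
    IsGreatest (Set.range fun x : X => klDiv (Q x).toMeasure (Q star).toMeasure)
        (AsyncComm.synchronizationThreshold Q star) ∧
      (∀ α : ℝ≥0, (α : ℝ≥0∞) < AsyncComm.synchronizationThreshold Q star →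
        AsyncComm.HasPositiveRateStrategy Q star α) ∧
      ((∃ y : Y, Q star y = 0 ∧ ∃ x : X, Q x y ≠ 0) →
        AsyncComm.synchronizationThreshold Q star = ⊤ ∧
          ∀ α : ℝ≥0, AsyncComm.IsAchievable Q star α 0 ∧
            AsyncComm.HasPositiveRateStrategy Q star α) := by
  have : Nonempty X := ⟨star⟩
  obtain ⟨x, hx⟩ := Finite.exists_max fun x : X => klDiv (Q x).toMeasure (Q star).toMeasure
  rw [AsyncComm.synchronizationThreshold_eq Q star x hx]
  refine ⟨⟨⟨x, rfl⟩, Set.forall_mem_range.2 hx⟩,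
    fun α hα => AsyncComm.hasPositiveRateStrategy_of_lt_klDiv Q star x hα, ?_⟩
  rintro ⟨y, hy, z, hz⟩
  have hztop : klDiv (Q z).toMeasure (Q star).toMeasure = ⊤ := by
    by_contra h
    exact hz ((AsyncComm.klDiv_pmf_ne_top_iff (Q z) (Q star)).1 h y hy)
  have htop : klDiv (Q x).toMeasure (Q star).toMeasure = ⊤ := top_le_iff.1 (hztop ▸ hx z)
  exact ⟨htop, fun α =>
    ⟨AsyncComm.isAchievable_zero_of_lt_klDiv Q star x (htop ▸ ENNReal.coe_lt_top),
      AsyncComm.hasPositiveRateStrategy_of_lt_klDiv Q star x (htop ▸ ENNReal.coe_lt_top)⟩⟩
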